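/- Let $k\ge 1$ and $n_1,\dots,n_k\ge 1$ be integers, let $B_n$ be the open unit ball of $\mathbb C^n$ and $S_n=\partial B_n$ the unit sphere. Put $\mathcal D=B_{n_1}\times\dots\times B_{n_k}$ and $\partial\mathcal D=S_{n_1}\times\dots\times S_{n_k}$ (the distinguished boundary), and let $\Sigma$ and $m$ be the normalized Lebesgue measures on $\partial\mathcal D$ and on the unit circle $\mathbb T$. For $f$ on $\mathcal D$ and $\zeta\in\partial\mathcal D$ write $f(\zeta)=\lim_{r\to1-}f(r\zeta)$ when this limit exists. The Hardy space $H^2=H^2(\mathcal D)$ consists of the holomorphic $f$ on $\mathcal D$ with $$\|f\|_{H^2}^2=\sup_{0<r<1}\int_{\partial\mathcal D}|f(r\zeta)|^2\,d\Sigma(\zeta)<\infty,$$ with inner product $(f,g)_{H^2}=\int_{\partial\mathcal D}f\overline g\,d\Sigma$ of the boundary values. Let $I$ be an inner function on $\mathcal D$, that is, a holomorphic map from $\mathcal D$ to the open unit disk such that the limit $I(\zeta)$ exists and $|I(\zeta)|=1$ for $\Sigma$-almost every $\zeta\in\partial\mathcal D$. Let $H^2\ominus IH^2$ be the set of all $f\in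 H^2$ with $(f,Ig)_{H^2}=0$ for all $g\in H^2$ (the large model space). Call a Lebesgue measurable set $E\subset\partial\mathcal D$ dominant for $H^2\ominus IH^2$ if $\Sigma(E)<1$ and there is a finite constant $C$ such that $$\|f\|_{H^2}^2\le C\int_E|f|^2\,d\Sigma\qquad\text{for all } f\in H^2\ominus IH^2.$$ Then there exists a dominant set for $H^2\ominus IH^2$. Concretely, for every Lebesgue measurable $Q\subset\mathbb T$ with $0<m(Q)<1$, the set $I^{-1}(Q)=\{\zeta\in\partial\mathcal D: I(\zeta)\text{ exists and } I(\zeta)\in Q\}$ is dominant for $H^2\ominus IH^2$. -/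

import Mathlib

open MeasureTheory Filter Topology
open scoped ENNReal NNReal ComplexConjugate

namespace DominantSets

/-- The ambient space `ℂ^{n₁} × ⋯ × ℂ^{n_k}`, each factor carrying its Euclidean norm. -/
abbrev Ambient {k : ℕ} (n : Fin k → ℕ) : Type :=
  (j : Fin k) → EuclideanSpace ℂ (Fin (n j))

/-- The domain `𝒟 = B_{n₁} × ⋯ × B_{n_k}`, a product of open Euclidean unit balls. -/
def domain {k : ℕ} (n : Fin k → ℕ) : Set (Ambient n) :=
  {z | ∀ j, ‖z j‖ < 1}

/-- The distinguished boundary `∂𝒟 = S_{n₁} × ⋯ × S_{n_k}`. -/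
abbrev Boundary {k : ℕ} (n : Fin k → ℕ) : Type :=
  (j : Fin k) → Metric.sphere (0 : EuclideanSpace ℂ (Fin (n j))) 1

/-- Normalized Lebesgue (surface) measure on the unit sphere of the complex Euclidean space `E`. -/
noncomputable def sphereMeasure (E : Type) [NormedAddCommGroup E] [NormedSpace ℝ E]
    [MeasureSpace E] : Measure (Metric.sphere (0 : E) 1) :=
  ((volume : Measure E).toSphere Set.univ)⁻¹ • (volume : Measure E).toSphere

/-- Normalized Lebesgue measure `m` on the unit circle `𝕋 = {z ∈ ℂ : ‖z‖ = 1}`. -/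
noncomputable def circleMeasure : Measure (Metric.sphere (0 : ℂ) 1) :=
  sphereMeasure ℂ

/-- Normalized Lebesgue measure `Σ` on the distinguished boundary. -/
noncomputable def boundaryMeasure {k : ℕ} (n : Fin k → ℕ) : Measure (Boundary n) :=
  Measure.pi fun j => sphereMeasure (EuclideanSpace ℂ (Fin (n j)))

/-- The point `r ζ = (r ζ₁, …, r ζ_k)`. -/
noncomputable def dilate {k : ℕ} {n : Fin k → ℕ} (r : ℝ) (ζ : Boundary n) : Ambient n :=
  fun j => (r : ℂ) • (ζ j : EuclideanSpace ℂ (Fin (n j)))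

/-- `w` is the radial limit `lim_{r → 1-} f (r ζ)`; in particular the limit exists. -/
def HasRadialLimit {k : ℕ} {n : Fin k → ℕ} (f : Ambient n → ℂ) (ζ : Boundary n) (w : ℂ) : Prop :=
  Tendsto (fun r : ℝ => f (dilate r ζ)) (𝓝[<] 1) (𝓝 w)

/-- The boundary function `f(ζ) = lim_{r → 1-} f (r ζ)` (with an arbitrary value at those `ζ` where
the limit does not exist). -/
noncomputable def boundaryValue {k : ℕ} {n : Fin k → ℕ} (f : Ambient n → ℂ) (ζ : Boundary n) : ℂ :=
  limUnder (𝓝[<] (1 : ℝ)) fun r : ℝ => f (dilate r ζ)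

/-- Inner functions on `𝒟`: holomorphic maps from `𝒟` into the open unit disk whose radial limits
have modulus one almost everywhere. Only the values of `I` on `𝒟` matter. -/
structure IsInner {k : ℕ} {n : Fin k → ℕ} (I : Ambient n → ℂ) : Prop where
  holomorphic : DifferentiableOn ℂ I (domain n)
  norm_lt_one : ∀ z ∈ domain n, ‖I z‖ < 1
  unimodular : ∀ᵐ ζ ∂(boundaryMeasure n), ∃ w : ℂ, HasRadialLimit I ζ w ∧ ‖w‖ = 1

/-- `‖f‖²_{H²} = sup_{0<r<1} ∫ |f(rζ)|² dΣ(ζ)`. -/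
noncomputable def hardyNormSq {k : ℕ} {n : Fin k → ℕ} (f : Ambient n → ℂ) : ℝ≥0∞ :=
  ⨆ r ∈ Set.Ioo (0 : ℝ) 1, ∫⁻ ζ, ‖f (dilate r ζ)‖ₑ ^ 2 ∂(boundaryMeasure n)

/-- The Hardy space `H²(𝒟)`, as a set of functions of which only the values on `𝒟` matter. -/
def hardySpace {k : ℕ} (n : Fin k → ℕ) : Set (Ambient n → ℂ) :=
  {f | DifferentiableOn ℂ f (domain n) ∧ hardyNormSq f < ∞}

/-- The inner product `(f, g)_{H²} = ∫ f \overline{g} dΣ`, in terms of boundary values. -/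
noncomputable def hardyInner {k : ℕ} {n : Fin k → ℕ} (f g : Ambient n → ℂ) : ℂ :=
  ∫ ζ, boundaryValue f ζ * conj (boundaryValue g ζ) ∂(boundaryMeasure n)

/-- The large model space `H² ⊖ I H²`: those `f ∈ H²` that are orthogonal to `I g`
for every `g ∈ H²`. -/
def largeModelSpace {k : ℕ} {n : Fin k → ℕ} (I : Ambient n → ℂ) : Set (Ambient n → ℂ) :=
  {f | f ∈ hardySpace n ∧ ∀ g ∈ hardySpace n, hardyInner f (fun z => I z * g z) = 0}

/-- `E` is dominant for `H² ⊖ I H²`: it is Lebesgue measurable, `Σ(E) < 1`, and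
`‖f‖² ≤ C ∫_E |f|² dΣ` for all `f ∈ H² ⊖ I H²`, with a finite constant `C` independent of `f`. -/
structure IsDominant {k : ℕ} {n : Fin k → ℕ} (I : Ambient n → ℂ) (E : Set (Boundary n)) : Prop where
  measurable : NullMeasurableSet E (boundaryMeasure n)
  measure_lt_one : boundaryMeasure n E < 1
  bound : ∃ C : ℝ≥0, ∀ f ∈ largeModelSpace I,
    hardyNormSq f ≤ C * ∫⁻ ζ in E, ‖boundaryValue f ζ‖ₑ ^ 2 ∂(boundaryMeasure n)

/-- The set `I⁻¹(Q) = {ζ ∈ ∂𝒟 : I(ζ) ∈ Q}`, where `I(ζ)` is the radial limit (required to exist). -/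
def boundaryPreimage {k : ℕ} {n : Fin k → ℕ} (I : Ambient n → ℂ)
    (Q : Set (Metric.sphere (0 : ℂ) 1)) : Set (Boundary n) :=
  {ζ | ∃ q ∈ Q, HasRadialLimit I ζ (q : ℂ)}

end DominantSets

/-!
Fix `f` in the large model space. For `m ≥ 1` the function `Iᵐ f = I · (Iᵐ⁻¹ f)` lies in `I H²`, so
`f` is orthogonal to it; on the boundary this reads `∫ |f|² Iᵐ dΣ = 0`, up to conjugation. Hence the
image under `I` of the measure `|f|² Σ` is a measure on the circle all of whose Fourier coefficients
except the zeroth vanish: it equals `‖f‖² m` (`IsInner.map_withDensity_eq`). In particular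
`∫_{I⁻¹(Q)} |f|² dΣ = m(Q) ‖f‖²`, which is the required inequality, with `C = 1 / m(Q)`.

Applied to the reproducing kernel `1 - \overline{I(0)} I` at the origin, whose boundary values vanish
almost nowhere, the same identity shows that `I⁻¹(Q)` is a null set exactly when `Q` is
(`IsInner.measure_preimage_eq_zero_iff`). This gives both the measurability of `I⁻¹(Q)` for Lebesgue
measurable `Q` and `Σ(I⁻¹(Q)) < 1` when `m(Q) < 1`.

The analytic input is that a function of `H²(𝒟)` has radial limits almost everywhere
(`ae_hasRadialLimit`), that its norm is the `L²` norm of these limits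
(`hardyNormSq_eq_lintegral_boundaryValue`), and that their integral is the value at the origin
(`integral_boundaryValue`). As `Σ` is invariant under the diagonal circle action `ζ ↦ e^{ix} ζ`,
almost every slice `z ↦ f (z ζ)` lies in the Hardy space of the disc, and all three facts follow by
integrating their one-dimensional versions over the orbits.

In the disc (`exists_radial_boundary_function`), the square summable Taylor coefficients define a
boundary function `F` in `L²` of the circle, to which the circle slices converge in `L²`. Thus `f` is
the Poisson integral of `F`, and it converges radially at the Lebesgue points of `F`, because the
Poisson kernel is dominated by a dyadic sum of normalized indicators of balls.
-/

namespace DominantSets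

/-! ### Approximate identities at Lebesgue points -/

/-- The kernel `h / (h² + s²)` is dominated by multiples of indicators of the dyadic balls
`{s ≤ 2ᵏ h}`: only the smallest `k` with `s ≤ 2ᵏ h` is needed. -/
lemma ofReal_div_sq_add_sq_le_tsum {h s : ℝ} (hh : 0 < h) :
    ENNReal.ofReal (h / (h ^ 2 + s ^ 2)) ≤
      ∑' k : ℕ, if s ≤ 2 ^ k * h then ENNReal.ofReal (4 / (4 ^ k * h)) else 0 := by
  have hex : ∃ k : ℕ, s ≤ 2 ^ k * h := by
    obtain ⟨k, hk⟩ := pow_unbounded_of_one_lt (s / h) (one_lt_two : (1 : ℝ) < 2)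
    exact ⟨k, ((div_lt_iff₀ hh).1 hk).le⟩
  classical
  refine le_trans ?_ (ENNReal.le_tsum (Nat.find hex))
  rw [if_pos (Nat.find_spec hex)]
  apply ENNReal.ofReal_le_ofReal
  rcases hk : Nat.find hex with _ | k
  · rw [div_le_div_iff₀ (by positivity) (by positivity)]
    nlinarith [sq_nonneg s, sq_nonneg h]
  · have hlt : 2 ^ k * h < s := by
      have := Nat.find_min hex (m := k) (by omega)
      simpa using this
    have h4 : (4 : ℝ) ^ k = (2 ^ k) ^ 2 := by rw [← pow_mul, mul_comm, pow_mul]; norm_num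
    have hsq : (2 ^ k * h) ^ 2 ≤ s ^ 2 := by gcongr
    rw [div_le_div_iff₀ (by positivity) (by positivity), pow_succ, h4]
    nlinarith [sq_nonneg h]

/-- Kernels of Poisson type are approximate identities at Lebesgue points: if the averages of `D`
over small balls around `x` tend to zero, then so do the integrals of `D` against
`h / (h² + d(·, x)²)`. -/
lemma tendsto_lintegral_kernel_mul {X : Type*} [PseudoMetricSpace X] [MeasurableSpace X]
    [OpensMeasurableSpace X] {μ : Measure X} {D : X → ℝ≥0∞} (hD : AEMeasurable D μ)
    (hfin : ∫⁻ y, D y ∂μ ≠ ∞) (x : X)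
    (hlim : Tendsto (fun u : ℝ => (∫⁻ y in Metric.closedBall x u, D y ∂μ) / ENNReal.ofReal u)
      (𝓝[>] 0) (𝓝 0)) :
    Tendsto (fun h : ℝ => ∫⁻ y, ENNReal.ofReal (h / (h ^ 2 + dist y x ^ 2)) * D y ∂μ)
      (𝓝[>] 0) (𝓝 0) := by
  set Φ : ℝ → ℝ≥0∞ := fun u => ∫⁻ y in Metric.closedBall x u, D y ∂μ
  have hle : ∀ h : ℝ, 0 < h → ∫⁻ y, ENNReal.ofReal (h / (h ^ 2 + dist y x ^ 2)) * D y ∂μ ≤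
      ∑' k : ℕ, ENNReal.ofReal (4 * (1 / 2) ^ k) * (Φ (2 ^ k * h) / ENNReal.ofReal (2 ^ k * h)) := by
    intro h hh
    calc ∫⁻ y, ENNReal.ofReal (h / (h ^ 2 + dist y x ^ 2)) * D y ∂μ
        ≤ ∫⁻ y, ∑' k : ℕ, (Metric.closedBall x (2 ^ k * h)).indicator
            (fun y => ENNReal.ofReal (4 / (4 ^ k * h)) * D y) y ∂μ := by
          refine lintegral_mono fun y => ?_
          refine (mul_le_mul_left (ofReal_div_sq_add_sq_le_tsum hh) _).trans ?_
          rw [← ENNReal.tsum_mul_right]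
          refine ENNReal.tsum_le_tsum fun k => ?_
          by_cases hy : dist y x ≤ 2 ^ k * h
          · simp [hy, Set.indicator, Metric.mem_closedBall]
          · simp [hy]
      _ = ∑' k : ℕ, ∫⁻ y, (Metric.closedBall x (2 ^ k * h)).indicator
            (fun y => ENNReal.ofReal (4 / (4 ^ k * h)) * D y) y ∂μ :=
          lintegral_tsum fun k => (hD.const_mul _).indicator Metric.isClosed_closedBall.measurableSet
      _ = _ := by
          refine tsum_congr fun k => ?_
          rw [lintegral_indicator Metric.isClosed_closedBall.measurableSet,
            lintegral_const_mul'' _ hD.restrict, ← mul_div_assoc, ENNReal.mul_div_right_comm,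
            ← ENNReal.ofReal_div_of_pos (by positivity)]
          congr 2
          have h4 : (4 : ℝ) ^ k = 2 ^ k * 2 ^ k := by rw [← mul_pow]; norm_num
          rw [h4, one_div, inv_pow]
          field_simp
  -- Dominated convergence over the dyadic scales: the averages are bounded at all scales, by the
  -- hypothesis near zero and by integrability of `D` away from it.
  have hM : ∃ M : ℝ≥0∞, M ≠ ∞ ∧ ∀ u : ℝ, 0 < u → Φ u / ENNReal.ofReal u ≤ M := by
    have h1 : ∀ᶠ u : ℝ in 𝓝[>] 0, Φ u / ENNReal.ofReal u < 1 := hlim.eventually_lt_const (by simp)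
    obtain ⟨δ, hδ, hδ'⟩ := mem_nhdsGT_iff_exists_Ioo_subset.1 h1
    have hδ0 : 0 < δ := hδ
    refine ⟨max 1 ((∫⁻ y, D y ∂μ) / ENNReal.ofReal δ), ?_, fun u hu => ?_⟩
    · exact (max_lt ENNReal.one_lt_top (ENNReal.div_lt_top hfin (by simpa using hδ0))).ne
    · rcases lt_or_ge u δ with h | h
      · exact (le_of_lt (hδ' ⟨hu, h⟩)).trans (le_max_left _ _)
      · refine le_trans ?_ (le_max_right _ _)
        exact ENNReal.div_le_div (setLIntegral_le_lintegral _ _) (ENNReal.ofReal_le_ofReal h)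
  obtain ⟨M, hM, hΦ⟩ := hM
  refine tendsto_of_tendsto_of_tendsto_of_le_of_le' tendsto_const_nhds ?_
    (Eventually.of_forall fun _ => zero_le)
    (eventually_mem_nhdsWithin.mono fun h hh => hle h hh)
  have key := tendsto_lintegral_filter_of_dominated_convergence (μ := Measure.count)
    (l := 𝓝[>] (0 : ℝ)) (f := fun _ : ℕ => (0 : ℝ≥0∞))
    (F := fun h k => ENNReal.ofReal (4 * (1 / 2) ^ k) *
      (Φ (2 ^ k * h) / ENNReal.ofReal (2 ^ k * h)))
    (fun k => ENNReal.ofReal (4 * (1 / 2) ^ k) * M)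
    (Eventually.of_forall fun _ => measurable_of_countable _)
    (eventually_mem_nhdsWithin.mono fun h hh => ae_of_all _ fun k => by
      have : (0 : ℝ) < h := hh
      exact mul_le_mul_right (hΦ _ (by positivity)) _) ?_ (ae_of_all _ fun k => ?_)
  · simpa [lintegral_count] using key
  · rw [lintegral_count, ENNReal.tsum_mul_right, ← ENNReal.ofReal_tsum_of_nonneg]
    · exact ENNReal.mul_ne_top ENNReal.ofReal_ne_top hM
    · intro k; positivity
    · exact (summable_geometric_of_lt_one (by norm_num) (by norm_num)).mul_left _
  · have hk : Tendsto (fun h : ℝ => 2 ^ k * h) (𝓝[>] 0) (𝓝[>] 0) := by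
      refine tendsto_nhdsWithin_iff.2 ⟨?_, eventually_mem_nhdsWithin.mono fun h hh => ?_⟩
      · have : Tendsto (fun h : ℝ => 2 ^ k * h) (𝓝 0) (𝓝 (2 ^ k * 0)) :=
          (continuous_const.mul continuous_id).tendsto 0
        rw [mul_zero] at this
        exact this.mono_left nhdsWithin_le_nhds
      · exact mul_pos (by positivity : (0 : ℝ) < 2 ^ k) hh
    have := ENNReal.Tendsto.const_mul (a := ENNReal.ofReal (4 * (1 / 2) ^ k)) (hlim.comp hk)
      (Or.inr ENNReal.ofReal_ne_top)
    simpa using this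

/-! ### Poisson integrals on the circle -/

local instance : Fact (0 < 2 * Real.pi) := ⟨Real.two_pi_pos⟩

local notation "𝕋" => AddCircle (2 * Real.pi)

lemma integrable_continuous_smul {X : Type*} [TopologicalSpace X] [CompactSpace X]
    [MeasurableSpace X] [OpensMeasurableSpace X] {μ : Measure X} {P : X → ℝ} (hP : Continuous P)
    {F : X → ℂ} (hF : Integrable F μ) : Integrable (fun y => P y • F y) μ := by
  obtain ⟨B, hB⟩ := isCompact_univ.exists_bound_of_continuousOn hP.continuousOn
  exact hF.bdd_smul B hP.aestronglyMeasurable (ae_of_all _ fun y => hB y (Set.mem_univ y))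

lemma toCircle_coe_eq_circleMap (R θ : ℝ) :
    (R : ℂ) * (AddCircle.toCircle (θ : 𝕋) : ℂ) = circleMap 0 R θ := by
  rw [AddCircle.toCircle_apply_mk, Circle.coe_exp, circleMap_zero, div_self Real.two_pi_pos.ne',
    one_mul]

lemma integral_toCircle_eq_circleAverage {E : Type*} [NormedAddCommGroup E] [NormedSpace ℝ E]
    (g : ℂ → E) (R : ℝ) :
    ∫ y : 𝕋, g (R * AddCircle.toCircle y) ∂AddCircle.haarAddCircle = Real.circleAverage g 0 R := by
  rw [AddCircle.integral_haarAddCircle, Real.circleAverage_def,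
    ← AddCircle.intervalIntegral_preimage (2 * Real.pi) 0, zero_add]
  simp_rw [toCircle_coe_eq_circleMap]

/-- Chords of the circle are comparable to arcs, by Jordan's inequality for the sine. -/
lemma norm_toCircle_sub_toCircle_ge (x y : 𝕋) :
    2 / Real.pi * dist x y ≤ ‖(AddCircle.toCircle x : ℂ) - AddCircle.toCircle y‖ := by
  have key : ∀ z : 𝕋, 2 / Real.pi * ‖z‖ ≤ ‖(AddCircle.toCircle z : ℂ) - 1‖ := by
    intro z
    obtain ⟨θ, hθ, rfl⟩ : ∃ θ : ℝ, |θ| ≤ Real.pi ∧ (θ : 𝕋) = z := by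
      obtain ⟨θ, hθ, rfl⟩ := AddCircle.coe_image_Icc_eq (2 * Real.pi) (-Real.pi) |>.ge
        (Set.mem_univ z)
      exact ⟨θ, abs_le.2 ⟨hθ.1, by linarith [hθ.2]⟩, rfl⟩
    have h1 : ‖(θ : 𝕋)‖ = |θ| := by
      rw [AddCircle.norm_coe_eq_abs_iff _ Real.two_pi_pos.ne', abs_of_pos Real.two_pi_pos]
      linarith
    have h2 := toCircle_coe_eq_circleMap 1 θ
    rw [Complex.ofReal_one, one_mul] at h2
    rw [h1, h2, circleMap_zero, Complex.ofReal_one, one_mul, mul_comm (θ : ℂ),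
      Complex.norm_exp_I_mul_ofReal_sub_one, norm_mul, Real.norm_eq_abs, Real.norm_eq_abs]
    have := Real.mul_abs_le_abs_sin (x := θ / 2) (by rw [abs_div, abs_two]; linarith)
    rw [abs_div, abs_two] at this
    rw [abs_two]
    linarith
  have hmul : (AddCircle.toCircle x : ℂ) - AddCircle.toCircle y =
      AddCircle.toCircle y * (AddCircle.toCircle (x - y) - 1) := by
    have : AddCircle.toCircle x = AddCircle.toCircle y * AddCircle.toCircle (x - y) := by
      rw [← AddCircle.toCircle_add, add_sub_cancel]
    rw [this, Circle.coe_mul]; ring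
  rw [hmul, norm_mul, Circle.norm_coe, one_mul, dist_eq_norm]
  exact key _

/-- On the circle the Poisson kernel is controlled by the rational kernel `h / (h² + d²)`,
where `h = 1 - r`. -/
lemma poissonKernel_toCircle_le {r : ℝ} (hr : 1 / 2 ≤ r) (hr1 : r < 1) (x y : 𝕋) :
    poissonKernel 0 (r * AddCircle.toCircle x) (AddCircle.toCircle y) ≤
      Real.pi ^ 2 * ((1 - r) / ((1 - r) ^ 2 + dist y x ^ 2)) := by
  have hd := norm_toCircle_sub_toCircle_ge y x
  set a : ℂ := ((AddCircle.toCircle x : Circle) : ℂ)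
  set b : ℂ := ((AddCircle.toCircle y : Circle) : ℂ)
  have ha : ‖a‖ = 1 := Circle.norm_coe _
  have hb : ‖b‖ = 1 := Circle.norm_coe _
  have hpi : 3 < Real.pi := Real.pi_gt_three
  have hd' : (2 / Real.pi * dist y x) ^ 2 ≤ ‖b - a‖ ^ 2 := by gcongr
  have hsq : ‖b - r * a‖ ^ 2 = (1 - r) ^ 2 + r * ‖b - a‖ ^ 2 := by
    have ha2 : a.re * a.re + a.im * a.im = 1 := by
      rw [← Complex.normSq_apply, Complex.normSq_eq_norm_sq, ha]; norm_num
    have hb2 : b.re * b.re + b.im * b.im = 1 := by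
      rw [← Complex.normSq_apply, Complex.normSq_eq_norm_sq, hb]; norm_num
    rw [← Complex.normSq_eq_norm_sq, ← Complex.normSq_eq_norm_sq, Complex.normSq_apply,
      Complex.normSq_apply]
    simp only [Complex.sub_re, Complex.sub_im, Complex.mul_re, Complex.mul_im, Complex.ofReal_re,
      Complex.ofReal_im]
    linear_combination (r ^ 2 - r) * ha2 + (1 - r) * hb2
  have hnr : ‖(r : ℂ) * a‖ = r := by
    rw [norm_mul, ha, mul_one, Complex.norm_real, Real.norm_of_nonneg (by linarith)]
  have hh : 0 < 1 - r := by linarith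
  have hlow : 2 / Real.pi ^ 2 * ((1 - r) ^ 2 + dist y x ^ 2) ≤ ‖b - r * a‖ ^ 2 := by
    have e1 : (2 / Real.pi * dist y x) ^ 2 = 2 * (2 / Real.pi ^ 2 * dist y x ^ 2) := by
      field_simp
    have e2 : 2 / Real.pi ^ 2 ≤ 1 := by
      rw [div_le_one (by positivity)]; nlinarith
    rw [hsq, mul_add]
    have : 2 / Real.pi ^ 2 * (1 - r) ^ 2 ≤ 1 * (1 - r) ^ 2 := by gcongr
    have h3 : 1 / 2 * ‖b - a‖ ^ 2 ≤ r * ‖b - a‖ ^ 2 := by gcongr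
    linarith
  rw [poissonKernel_def, sub_zero, sub_zero, hb, hnr]
  have hpos : 0 < (1 - r) ^ 2 + dist y x ^ 2 := by positivity
  calc (1 ^ 2 - r ^ 2) / ‖b - r * a‖ ^ 2
      ≤ (2 * (1 - r)) / (2 / Real.pi ^ 2 * ((1 - r) ^ 2 + dist y x ^ 2)) := by
        gcongr
        nlinarith
    _ = _ := by field_simp

lemma poissonKernel_nonneg_of_norm_le {w z : ℂ} (h : ‖w‖ ≤ ‖z‖) : 0 ≤ poissonKernel 0 w z := by
  rw [poissonKernel_def, sub_zero, sub_zero]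
  exact div_nonneg (sub_nonneg.2 (by gcongr)) (sq_nonneg _)

lemma continuous_poissonKernel_toCircle {w : ℂ} (hw : ‖w‖ < 1) :
    Continuous fun y : 𝕋 => poissonKernel 0 w (AddCircle.toCircle y) := by
  have hc : Continuous fun y : 𝕋 => (AddCircle.toCircle y : ℂ) :=
    continuous_subtype_val.comp AddCircle.continuous_toCircle
  simp only [poissonKernel_def, sub_zero]
  refine Continuous.div (by fun_prop) (by fun_prop) fun y => ?_
  have : (AddCircle.toCircle y : ℂ) ≠ w := by
    intro h
    rw [← h, Circle.norm_coe] at hw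
    exact lt_irrefl _ hw
  simpa [sub_eq_zero] using this

/-- The Poisson formula as an integral over `ℝ / 2πℤ`. -/
lemma integral_poissonKernel_smul {f : ℂ → ℂ} (hf : DiffContOnCl ℂ f (Metric.ball 0 1)) {w : ℂ}
    (hw : ‖w‖ < 1) :
    ∫ y : 𝕋, poissonKernel 0 w (AddCircle.toCircle y) • f (AddCircle.toCircle y)
      ∂AddCircle.haarAddCircle = f w := by
  have h := integral_toCircle_eq_circleAverage (poissonKernel 0 w • f) 1
  rw [hf.circleAverage_poissonKernel_smul (by simpa using hw)] at h
  simpa using h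

lemma haarAddCircle_eq_smul_volume :
    (AddCircle.haarAddCircle : Measure 𝕋) = (ENNReal.ofReal (2 * Real.pi))⁻¹ • volume := by
  rw [AddCircle.volume_eq_smul_haarAddCircle, smul_smul, ENNReal.inv_mul_cancel
    (by simpa using Real.pi_pos) ENNReal.ofReal_ne_top, one_smul]

/-- Almost every point of the circle is a Lebesgue point of a given integrable function. -/
lemma ae_tendsto_lintegral_closedBall_div {F : 𝕋 → ℂ} (hF : Integrable F) :
    ∀ᵐ x : 𝕋, Tendsto (fun u : ℝ =>
      (∫⁻ y in Metric.closedBall x u, ‖F y - F x‖ₑ) / ENNReal.ofReal u) (𝓝[>] 0) (𝓝 0) := by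
  filter_upwards [IsUnifLocDoublingMeasure.ae_tendsto_average_norm_sub volume
    hF.locallyIntegrable 1] with x hx
  have h1 := hx (l := 𝓝[>] (0 : ℝ)) (fun _ => x) id tendsto_id
    (eventually_mem_nhdsWithin.mono fun u hu => by
      have : (0 : ℝ) < u := hu
      simp [this.le])
  have h2 := ENNReal.tendsto_ofReal (h1.const_mul 2)
  rw [mul_zero, ENNReal.ofReal_zero] at h2
  refine h2.congr' ?_
  have hsmall : ∀ᶠ u : ℝ in 𝓝[>] 0, u < Real.pi :=
    nhdsWithin_le_nhds (Iio_mem_nhds Real.pi_pos)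
  filter_upwards [hsmall, eventually_mem_nhdsWithin] with u hu hu0
  have hu0' : (0 : ℝ) < u := hu0
  have hvol : volume.real (Metric.closedBall x u) = 2 * u := by
    rw [measureReal_def, AddCircle.volume_closedBall, min_eq_right (by linarith),
      ENNReal.toReal_ofReal (by positivity)]
  have hint : Integrable (fun y => F y - F x) := hF.sub (integrable_const _)
  rw [id, setAverage_eq, hvol, smul_eq_mul, ← mul_assoc,
    show 2 * (2 * u)⁻¹ = u⁻¹ by field_simp, ENNReal.ofReal_mul (by positivity),
    ofReal_integral_norm_eq_lintegral_enorm hint.restrict, ENNReal.ofReal_inv_of_pos hu0',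
    mul_comm, div_eq_mul_inv]

/-- The Poisson kernel has integral one, so the error `P[F] - c` is an average of `F - c`. -/
lemma enorm_integral_poissonKernel_sub_le {F : 𝕋 → ℂ}
    (hF : Integrable F AddCircle.haarAddCircle) (c : ℂ) (x : 𝕋) {r : ℝ} (hr : 1 / 2 ≤ r)
    (hr1 : r < 1) :
    ‖(∫ y : 𝕋, poissonKernel 0 (r * AddCircle.toCircle x) (AddCircle.toCircle y) • F y
        ∂AddCircle.haarAddCircle) - c‖ₑ ≤
      (ENNReal.ofReal (2 * Real.pi))⁻¹ * ENNReal.ofReal (Real.pi ^ 2) *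
        ∫⁻ y, ENNReal.ofReal ((1 - r) / ((1 - r) ^ 2 + dist y x ^ 2)) * ‖F y - c‖ₑ := by
  have hnorm : ‖(r : ℂ) * (AddCircle.toCircle x : Circle)‖ < 1 := by
    rw [norm_mul, Circle.norm_coe, mul_one, Complex.norm_real, Real.norm_of_nonneg (by linarith)]
    exact hr1
  have hPc := continuous_poissonKernel_toCircle hnorm
  have hP0 : ∀ y : 𝕋, 0 ≤ poissonKernel 0 (r * AddCircle.toCircle x) (AddCircle.toCircle y) :=
    fun y => poissonKernel_nonneg_of_norm_le (by rw [Circle.norm_coe]; exact hnorm.le)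
  have hPle := poissonKernel_toCircle_le hr hr1 x
  have hone := integral_poissonKernel_smul (f := fun _ => c) diffContOnCl_const hnorm
  generalize hPdef : (fun y : 𝕋 => poissonKernel 0 (r * AddCircle.toCircle x)
    (AddCircle.toCircle y)) = P at hPc
  simp only [funext_iff] at hPdef
  simp only [hPdef] at hP0 hPle hone ⊢
  have hPF := integrable_continuous_smul hPc hF
  have hPc' := integrable_continuous_smul hPc (μ := AddCircle.haarAddCircle) (integrable_const c)
  have hdiff : (∫ y, P y • F y ∂AddCircle.haarAddCircle) - c =
      ∫ y, P y • (F y - c) ∂AddCircle.haarAddCircle := by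
    simp_rw [smul_sub]
    rw [integral_sub hPF hPc', hone]
  rw [hdiff]
  refine (enorm_integral_le_lintegral_enorm _).trans ?_
  rw [haarAddCircle_eq_smul_volume, lintegral_smul_measure, smul_eq_mul, mul_assoc]
  refine mul_le_mul_right ?_ _
  rw [← lintegral_const_mul' _ _ ENNReal.ofReal_ne_top]
  refine lintegral_mono fun y => ?_
  rw [enorm_smul, ← mul_assoc, ← ENNReal.ofReal_mul (by positivity), Real.enorm_of_nonneg (hP0 y)]
  exact mul_le_mul_left (ENNReal.ofReal_le_ofReal (hPle y)) _

/-- The Poisson integrals of an integrable function converge radially at almost every point. -/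
theorem ae_tendsto_integral_poissonKernel {F : 𝕋 → ℂ}
    (hF : Integrable F AddCircle.haarAddCircle) :
    ∀ᵐ x ∂(AddCircle.haarAddCircle : Measure 𝕋), Tendsto
      (fun r : ℝ => ∫ y : 𝕋, poissonKernel 0 (r * AddCircle.toCircle x) (AddCircle.toCircle y) • F y
        ∂AddCircle.haarAddCircle) (𝓝[<] 1) (𝓝 (F x)) := by
  have hFv : Integrable F := by
    rw [AddCircle.volume_eq_smul_haarAddCircle]
    exact hF.smul_measure ENNReal.ofReal_ne_top
  have hae : (AddCircle.haarAddCircle : Measure 𝕋) ≪ volume := by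
    rw [haarAddCircle_eq_smul_volume]
    exact Measure.smul_absolutelyContinuous
  filter_upwards [hae.ae_le (ae_tendsto_lintegral_closedBall_div hFv)] with x hx
  have hint : Integrable (fun y => F y - F x) := hFv.sub (integrable_const _)
  have hker := tendsto_lintegral_kernel_mul hint.aestronglyMeasurable.enorm
    hint.hasFiniteIntegral.ne x hx
  have hsub : Tendsto (fun r : ℝ => 1 - r) (𝓝[<] 1) (𝓝[>] 0) := by
    refine tendsto_nhdsWithin_iff.2 ⟨?_, eventually_mem_nhdsWithin.mono fun r hr => ?_⟩
    · have : Tendsto (fun r : ℝ => 1 - r) (𝓝 1) (𝓝 (1 - 1)) :=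
        (continuous_const.sub continuous_id).tendsto 1
      rw [sub_self] at this
      exact this.mono_left nhdsWithin_le_nhds
    · exact sub_pos.2 (Set.mem_Iio.1 hr)
  have hlim := ENNReal.Tendsto.const_mul
    (a := (ENNReal.ofReal (2 * Real.pi))⁻¹ * ENNReal.ofReal (Real.pi ^ 2)) (hker.comp hsub)
    (Or.inr (ENNReal.mul_ne_top (by simpa using Real.pi_pos) ENNReal.ofReal_ne_top))
  rw [mul_zero] at hlim
  rw [tendsto_iff_edist_tendsto_0]
  refine tendsto_of_tendsto_of_tendsto_of_le_of_le' tendsto_const_nhds hlim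
    (Eventually.of_forall fun _ => zero_le) ?_
  have hhalf : ∀ᶠ r : ℝ in 𝓝[<] 1, 1 / 2 < r :=
    nhdsWithin_le_nhds (Ioi_mem_nhds (by norm_num))
  filter_upwards [hhalf, eventually_mem_nhdsWithin] with r hr hr1
  rw [edist_eq_enorm_sub]
  exact enorm_integral_poissonKernel_sub_le hF (F x) x hr.le hr1

/-! ### The Hardy space of the disc -/

lemma lintegral_enorm_sq_eq_eLpNorm_sq {X : Type*} [MeasurableSpace X] (μ : Measure X)
    (g : X → ℂ) : ∫⁻ x, ‖g x‖ₑ ^ 2 ∂μ = eLpNorm g 2 μ ^ 2 := by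
  have := eLpNorm_nnreal_pow_eq_lintegral (f := g) (μ := μ) (p := 2) (by norm_num)
  simpa using this.symm

lemma norm_ofReal_mul_toCircle {r : ℝ} (hr : 0 ≤ r) (x : 𝕋) :
    ‖(r : ℂ) * (AddCircle.toCircle x : Circle)‖ = r := by
  rw [norm_mul, Circle.norm_coe, mul_one, Complex.norm_real, Real.norm_of_nonneg hr]

/-- The `n`-th Taylor coefficient of `f` at the origin. -/
noncomputable def taylorCoeff (f : ℂ → ℂ) (n : ℕ) : ℂ :=
  (n.factorial : ℂ)⁻¹ * iteratedDeriv n f 0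

lemma hasSum_taylorCoeff {f : ℂ → ℂ} (hf : DifferentiableOn ℂ f (Metric.ball 0 1)) {z : ℂ}
    (hz : ‖z‖ < 1) : HasSum (fun n => taylorCoeff f n * z ^ n) (f z) := by
  have h := Complex.hasSum_taylorSeries_on_ball hf (z := z) (by simpa using hz)
  refine h.congr_fun fun n => ?_
  simp only [taylorCoeff, sub_zero, smul_eq_mul]
  ring

lemma summable_norm_taylorCoeff {f : ℂ → ℂ} (hf : DifferentiableOn ℂ f (Metric.ball 0 1)) {r : ℝ}
    (hr : 0 ≤ r) (hr1 : r < 1) : Summable fun n => ‖taylorCoeff f n * (r : ℂ) ^ n‖ :=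
  (hasSum_taylorCoeff hf (z := r)
    (by rwa [Complex.norm_real, Real.norm_of_nonneg hr])).summable.norm

lemma continuous_circle_slice {f : ℂ → ℂ} (hf : DifferentiableOn ℂ f (Metric.ball 0 1)) {r : ℝ}
    (hr : 0 ≤ r) (hr1 : r < 1) : Continuous fun x : 𝕋 => f (r * AddCircle.toCircle x) := by
  have hc : Continuous fun x : 𝕋 => (AddCircle.toCircle x : ℂ) :=
    continuous_subtype_val.comp AddCircle.continuous_toCircle
  refine hf.continuousOn.comp_continuous (continuous_const.mul hc) fun x => ?_
  rw [mem_ball_zero_iff, norm_ofReal_mul_toCircle hr]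
  exact hr1

/-- The isometric embedding of `ℓ²(ℕ)` into `L²` of the circle that sends `a` to `∑ aₙ eⁱⁿˣ`;
its range is the Hardy space of the circle. -/
noncomputable def hardyIsometry :
    lp (fun _ : ℕ => ℂ) 2 →ₗᵢ[ℂ] Lp ℂ 2 (AddCircle.haarAddCircle : Measure 𝕋) :=
  (orthonormal_fourier.comp (fun n : ℕ => (n : ℤ)) Nat.cast_injective).orthogonalFamily.linearIsometry

/-- The circle slice `x ↦ f (r eⁱˣ)` is the image of the sequence `aₙ rⁿ`. -/
lemma hardyIsometry_ae_eq {f : ℂ → ℂ} (hf : DifferentiableOn ℂ f (Metric.ball 0 1)) {r : ℝ}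
    (hr : 0 ≤ r) (hr1 : r < 1) (w : lp (fun _ : ℕ => ℂ) 2)
    (hw : ∀ n, w n = taylorCoeff f n * (r : ℂ) ^ n) :
    hardyIsometry w =ᵐ[AddCircle.haarAddCircle] fun x : 𝕋 => f (r * AddCircle.toCircle x) := by
  set U : C(𝕋, ℂ) := ⟨_, continuous_circle_slice hf hr hr1⟩
  have hsum : HasSum (fun n : ℕ => (taylorCoeff f n * (r : ℂ) ^ n) • (fourier (n : ℤ) : C(𝕋, ℂ)))
      U := by
    have hs : Summable
        (fun n : ℕ => (taylorCoeff f n * (r : ℂ) ^ n) • (fourier (n : ℤ) : C(𝕋, ℂ))) := by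
      refine Summable.of_norm ?_
      simp_rw [norm_smul, fourier_norm, mul_one]
      exact summable_norm_taylorCoeff hf hr hr1
    convert hs.hasSum
    ext x
    have h1 := ContinuousMap.hasSum_apply hs.hasSum x
    have h2 := hasSum_taylorCoeff hf (z := r * AddCircle.toCircle x)
      (by rwa [norm_ofReal_mul_toCircle hr])
    refine h2.unique (h1.congr_fun fun n => ?_)
    rw [ContinuousMap.smul_apply, fourier_apply, AddCircle.toCircle_zsmul, smul_eq_mul, mul_pow]
    simp [mul_assoc]
  have h1 := (ContinuousMap.toLp (E := ℂ) 2 (AddCircle.haarAddCircle : Measure 𝕋) ℂ).hasSum hsum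
  have h2 := (orthonormal_fourier (T := 2 * Real.pi) |>.comp (fun n : ℕ => (n : ℤ))
    Nat.cast_injective).orthogonalFamily.hasSum_linearIsometry w
  have h3 : hardyIsometry w = ContinuousMap.toLp 2 AddCircle.haarAddCircle ℂ U := by
    refine h2.unique (h1.congr_fun fun n => ?_)
    simp [hw, fourierLp]
  rw [h3]
  exact ContinuousMap.coeFn_toLp _ U

lemma lintegral_hardyIsometry (w : lp (fun _ : ℕ => ℂ) 2) :
    ∫⁻ x, ‖hardyIsometry w x‖ₑ ^ 2 ∂(AddCircle.haarAddCircle : Measure 𝕋) = ‖w‖ₑ ^ 2 := by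
  rw [lintegral_enorm_sq_eq_eLpNorm_sq, ← Lp.enorm_def, ← ofReal_norm, LinearIsometry.norm_map,
    ofReal_norm]

lemma lintegral_circle_slice {f : ℂ → ℂ} (hf : DifferentiableOn ℂ f (Metric.ball 0 1)) {r : ℝ}
    (hr : 0 ≤ r) (hr1 : r < 1) (w : lp (fun _ : ℕ => ℂ) 2)
    (hw : ∀ n, w n = taylorCoeff f n * (r : ℂ) ^ n) :
    ∫⁻ x : 𝕋, ‖f (r * AddCircle.toCircle x)‖ₑ ^ 2 ∂AddCircle.haarAddCircle = ‖w‖ₑ ^ 2 := by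
  rw [← lintegral_hardyIsometry]
  refine lintegral_congr_ae ?_
  filter_upwards [hardyIsometry_ae_eq hf hr hr1 w hw] with x hx
  rw [hx]

/-- A sequence of Taylor coefficients damped by `rⁿ`, `r < 1`, is square summable. -/
lemma memℓp_taylorCoeff_mul_pow {f : ℂ → ℂ} (hf : DifferentiableOn ℂ f (Metric.ball 0 1)) {r : ℝ}
    (hr : 0 ≤ r) (hr1 : r < 1) : Memℓp (fun n => taylorCoeff f n * (r : ℂ) ^ n) 2 := by
  have h1 : Memℓp (fun n => taylorCoeff f n * (r : ℂ) ^ n) 1 :=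
    memℓp_gen (by simpa using summable_norm_taylorCoeff hf hr hr1)
  exact h1.of_exponent_ge (by norm_num)

/-- Bessel's inequality on the circles of radius `r`, and then `r → 1`. -/
lemma memℓp_taylorCoeff {f : ℂ → ℂ} (hf : DifferentiableOn ℂ f (Metric.ball 0 1))
    {C : ℝ≥0∞} (hC : C ≠ ∞) (hfC : ∃ᶠ r : ℝ in 𝓝[<] 1,
      ∫⁻ x : 𝕋, ‖f (r * AddCircle.toCircle x)‖ₑ ^ 2 ∂AddCircle.haarAddCircle ≤ C) :
    Memℓp (taylorCoeff f) 2 := by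
  refine memℓp_gen' (C := C.toReal) fun s => ?_
  simp only [ENNReal.toReal_ofNat, Real.rpow_ofNat]
  have hlim : Tendsto (fun r : ℝ => ∑ n ∈ s, ‖taylorCoeff f n * (r : ℂ) ^ n‖ ^ 2) (𝓝[<] 1)
      (𝓝 (∑ n ∈ s, ‖taylorCoeff f n‖ ^ 2)) := by
    have hcont : Continuous fun r : ℝ => ∑ n ∈ s, ‖taylorCoeff f n * (r : ℂ) ^ n‖ ^ 2 := by
      fun_prop
    simpa using (hcont.tendsto 1).mono_left nhdsWithin_le_nhds
  refine le_of_tendsto_of_frequently hlim ?_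
  have h0 : ∀ᶠ r : ℝ in 𝓝[<] 1, 0 < r := nhdsWithin_le_nhds (Ioi_mem_nhds one_pos)
  refine (hfC.and_eventually (h0.and eventually_mem_nhdsWithin)).mono ?_
  rintro r ⟨hrC, hr0, hr1⟩
  set w : lp (fun _ : ℕ => ℂ) 2 := ⟨_, memℓp_taylorCoeff_mul_pow hf hr0.le hr1⟩ with hw
  have hle := lp.sum_rpow_le_norm_rpow (by simp) w s
  simp only [ENNReal.toReal_ofNat, Real.rpow_ofNat] at hle
  refine hle.trans ?_
  have h2 : ‖w‖ₑ ^ 2 ≤ C :=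
    (lintegral_circle_slice hf hr0.le hr1 w fun n => rfl).symm.trans_le hrC
  have h3 := ENNReal.toReal_mono hC h2
  simpa using h3

/-- A holomorphic function on the disc with square integrable circle slices has a boundary function
`F` in `L²`: the slices converge to `F` in `L²`, and their norms are bounded by that of `F`. -/
lemma exists_boundary_function {f : ℂ → ℂ} (hf : DifferentiableOn ℂ f (Metric.ball 0 1))
    {C : ℝ≥0∞} (hC : C ≠ ∞) (hfC : ∃ᶠ r : ℝ in 𝓝[<] 1,
      ∫⁻ x : 𝕋, ‖f (r * AddCircle.toCircle x)‖ₑ ^ 2 ∂AddCircle.haarAddCircle ≤ C) :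
    ∃ F : 𝕋 → ℂ, MemLp F 2 AddCircle.haarAddCircle ∧
      Tendsto (fun r : ℝ => eLpNorm (fun x => f (r * AddCircle.toCircle x) - F x) 2
        AddCircle.haarAddCircle) (𝓝[<] 1) (𝓝 0) ∧
      ∀ r ∈ Set.Ioo (0 : ℝ) 1,
        ∫⁻ x : 𝕋, ‖f (r * AddCircle.toCircle x)‖ₑ ^ 2 ∂AddCircle.haarAddCircle ≤
          ∫⁻ x, ‖F x‖ₑ ^ 2 ∂AddCircle.haarAddCircle := by
  have ha := memℓp_taylorCoeff hf hC hfC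
  set a : lp (fun _ : ℕ => ℂ) 2 := ⟨_, ha⟩
  have hsq : Summable fun n => ‖taylorCoeff f n‖ ^ 2 := by
    have := ha.summable (by simp)
    simpa using this
  have hex : ∀ r : ℝ, ∃ w : lp (fun _ : ℕ => ℂ) 2, r ∈ Set.Ioo (0 : ℝ) 1 →
      ∀ n, w n = taylorCoeff f n * (r : ℂ) ^ n := by
    intro r
    by_cases hr : r ∈ Set.Ioo (0 : ℝ) 1
    · exact ⟨⟨_, memℓp_taylorCoeff_mul_pow hf hr.1.le hr.2⟩, fun _ n => rfl⟩
    · exact ⟨0, fun h => absurd h hr⟩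
  choose w hw using hex
  have hIoo : ∀ᶠ r : ℝ in 𝓝[<] 1, r ∈ Set.Ioo (0 : ℝ) 1 := Ioo_mem_nhdsLT one_pos
  have hnorm : ∀ v : lp (fun _ : ℕ => ℂ) 2, ‖v‖ ^ 2 = ∑' n, ‖v n‖ ^ 2 := by
    intro v
    have := lp.norm_rpow_eq_tsum (p := 2) (by simp) v
    simpa using this
  have hslice : ∀ r ∈ Set.Ioo (0 : ℝ) 1, hardyIsometry (w r) =ᵐ[AddCircle.haarAddCircle]
      fun x : 𝕋 => f (r * AddCircle.toCircle x) := fun r hr =>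
    hardyIsometry_ae_eq hf hr.1.le hr.2 _ (hw r hr)
  have hlim : Tendsto (fun r => ‖w r - a‖ ^ 2) (𝓝[<] 1) (𝓝 0) := by
    -- By Parseval, `‖w r - a‖² = ∑ |aₙ|² (1 - rⁿ)²`, to which dominated convergence applies.
    have hlim' : Tendsto (fun r : ℝ => ∑' n, ‖taylorCoeff f n * (r : ℂ) ^ n - taylorCoeff f n‖ ^ 2)
        (𝓝[<] 1) (𝓝 (∑' _ : ℕ, (0 : ℝ))) := by
      refine tendsto_tsum_of_dominated_convergence hsq (fun n => ?_) ?_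
      · have hcont : Continuous fun r : ℝ =>
            ‖taylorCoeff f n * (r : ℂ) ^ n - taylorCoeff f n‖ ^ 2 := by fun_prop
        simpa using (hcont.tendsto 1).mono_left nhdsWithin_le_nhds
      · filter_upwards [hIoo] with r hr n
        have h1 : taylorCoeff f n * (r : ℂ) ^ n - taylorCoeff f n =
            taylorCoeff f n * ((r ^ n - 1 : ℝ) : ℂ) := by push_cast; ring
        have h2 : |r ^ n - 1| ≤ 1 := by
          have h3 := pow_nonneg hr.1.le n
          have h4 := pow_le_one₀ (n := n) hr.1.le hr.2.le
          rw [abs_le]; constructor <;> linarith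
        rw [h1, norm_mul, Complex.norm_real, Real.norm_of_nonneg (sq_nonneg _)]
        refine pow_le_pow_left₀ (mul_nonneg (norm_nonneg _) (norm_nonneg _)) ?_ 2
        exact mul_le_of_le_one_right (norm_nonneg _) h2
    rw [tsum_zero] at hlim'
    refine hlim'.congr' ?_
    filter_upwards [hIoo] with r hr
    rw [hnorm]
    refine tsum_congr fun n => ?_
    rw [lp.coeFn_sub, Pi.sub_apply, hw r hr]
  refine ⟨hardyIsometry a, Lp.memLp _, ?_, fun r hr => ?_⟩
  · have h1 : Tendsto (fun r => ‖w r - a‖ₑ) (𝓝[<] 1) (𝓝 0) := by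
      have h2 : Tendsto (fun r => ‖w r - a‖) (𝓝[<] 1) (𝓝 0) := by
        have := hlim.sqrt
        simpa [Real.sqrt_sq] using this
      simpa [← ofReal_norm] using ENNReal.tendsto_ofReal h2
    refine h1.congr' ?_
    filter_upwards [hIoo] with r hr
    have h2 : ‖hardyIsometry (w r - a)‖ₑ = ‖w r - a‖ₑ := by
      rw [← ofReal_norm, LinearIsometry.norm_map, ofReal_norm]
    rw [← h2, map_sub, Lp.enorm_def]
    refine eLpNorm_congr_ae ?_
    filter_upwards [hslice r hr, Lp.coeFn_sub (hardyIsometry (w r)) (hardyIsometry a)] with x hx hx'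
    rw [hx', Pi.sub_apply, hx]
  · rw [lintegral_circle_slice hf hr.1.le hr.2 _ (hw r hr), lintegral_hardyIsometry]
    have h2 : ‖w r‖ ^ 2 ≤ ‖a‖ ^ 2 := by
      rw [hnorm, hnorm]
      have hle : ∀ n, ‖w r n‖ ^ 2 ≤ ‖a n‖ ^ 2 := by
        intro n
        rw [hw r hr, norm_mul, norm_pow, Complex.norm_real, Real.norm_of_nonneg hr.1.le]
        refine pow_le_pow_left₀ (mul_nonneg (norm_nonneg _) (pow_nonneg hr.1.le n)) ?_ 2
        exact mul_le_of_le_one_right (norm_nonneg _) (pow_le_one₀ hr.1.le hr.2.le)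
      exact Summable.tsum_le_tsum hle (hsq.of_nonneg_of_le (fun n => by positivity) hle) hsq
    have h3 : ‖w r‖ ≤ ‖a‖ := le_of_sq_le_sq h2 (norm_nonneg _)
    gcongr
    rw [← ofReal_norm, ← ofReal_norm]
    exact ENNReal.ofReal_le_ofReal h3

/-- The Poisson formula for the boundary function. -/
lemma integral_poissonKernel_smul_boundary {f : ℂ → ℂ} {F : 𝕋 → ℂ} (hf : DifferentiableOn ℂ f (Metric.ball 0 1))
    (hF : MemLp F 2 (AddCircle.haarAddCircle : Measure 𝕋))
    (hlim : Tendsto (fun r : ℝ => eLpNorm (fun x => f (r * AddCircle.toCircle x) - F x) 2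
        AddCircle.haarAddCircle) (𝓝[<] 1) (𝓝 0)) {w : ℂ} (hw : ‖w‖ < 1) :
    ∫ y : 𝕋, poissonKernel 0 w (AddCircle.toCircle y) • F y ∂AddCircle.haarAddCircle = f w := by
  have hP := continuous_poissonKernel_toCircle hw
  have hIoo : ∀ᶠ r : ℝ in 𝓝[<] 1, r ∈ Set.Ioo (0 : ℝ) 1 := Ioo_mem_nhdsLT one_pos
  obtain ⟨B, hB⟩ := isCompact_univ.exists_bound_of_continuousOn hP.continuousOn
  have hf1 : Tendsto (fun r : ℝ => f (r * w)) (𝓝[<] 1) (𝓝 (f w)) := by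
    have hc : ContinuousAt f w :=
      hf.continuousOn.continuousAt (Metric.isOpen_ball.mem_nhds (by simpa using hw))
    have h1 : Tendsto (fun r : ℝ => (r : ℂ) * w) (𝓝[<] 1) (𝓝 w) := by
      have hcont : Continuous fun r : ℝ => (r : ℂ) * w := by fun_prop
      simpa using (hcont.tendsto 1).mono_left nhdsWithin_le_nhds
    exact hc.tendsto.comp h1
  refine tendsto_nhds_unique ?_ hf1
  have hpoisson : ∀ᶠ r : ℝ in 𝓝[<] 1, ∫ y : 𝕋, poissonKernel 0 w (AddCircle.toCircle y) •
      f (r * AddCircle.toCircle y) ∂AddCircle.haarAddCircle = f (r * w) := by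
    filter_upwards [hIoo] with r hr
    refine integral_poissonKernel_smul (f := fun z => f (r * z)) ?_ hw
    refine DifferentiableOn.diffContOnCl ?_
    rw [closure_ball _ one_ne_zero]
    refine hf.comp (by fun_prop) fun z hz => ?_
    rw [mem_closedBall_zero_iff] at hz
    rw [mem_ball_zero_iff, norm_mul, Complex.norm_real, Real.norm_of_nonneg hr.1.le]
    nlinarith [hr.1, hr.2, norm_nonneg z]
  -- The Poisson kernel of `w` is bounded on the circle, so `L²` convergence of the slices passes to
  -- their Poisson integrals.
  refine Tendsto.congr' hpoisson ?_
  refine tendsto_integral_of_L1' _ (integrable_continuous_smul hP (hF.integrable (by norm_num))).1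
    ?_ ?_
  · filter_upwards [hIoo] with r hr
    exact integrable_continuous_smul hP
      ((continuous_circle_slice hf hr.1.le hr.2).integrable_of_hasCompactSupport
        (HasCompactSupport.of_compactSpace _))
  · have h2 := ENNReal.Tendsto.const_mul (a := ENNReal.ofReal B) hlim
      (Or.inr ENNReal.ofReal_ne_top)
    rw [mul_zero] at h2
    refine tendsto_of_tendsto_of_tendsto_of_le_of_le' tendsto_const_nhds h2
      (Eventually.of_forall fun _ => zero_le) ?_
    filter_upwards [hIoo] with r hr
    have hmeas : AEStronglyMeasurable (fun x : 𝕋 => f (r * AddCircle.toCircle x) - F x)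
        AddCircle.haarAddCircle :=
      (continuous_circle_slice hf hr.1.le hr.2).aestronglyMeasurable.sub hF.1
    refine (eLpNorm_le_mul_eLpNorm_of_ae_le_mul
      (g := fun x : 𝕋 => f (r * AddCircle.toCircle x) - F x) (c := B) (ae_of_all _ fun y => ?_)
      1).trans ?_
    · simp only [Pi.sub_apply]
      rw [← smul_sub, norm_smul]
      gcongr
      exact hB y (Set.mem_univ y)
    · gcongr
      exact eLpNorm_le_eLpNorm_of_exponent_le (by norm_num) hmeas

/-- **Fatou's theorem** for the Hardy space `H²` of the disc. -/
theorem exists_radial_boundary_function {f : ℂ → ℂ}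
    (hf : DifferentiableOn ℂ f (Metric.ball 0 1))
    {C : ℝ≥0∞} (hC : C ≠ ∞) (hfC : ∃ᶠ r : ℝ in 𝓝[<] 1,
      ∫⁻ x : 𝕋, ‖f (r * AddCircle.toCircle x)‖ₑ ^ 2 ∂AddCircle.haarAddCircle ≤ C) :
    ∃ F : 𝕋 → ℂ,
      (∀ᵐ x ∂AddCircle.haarAddCircle,
        Tendsto (fun r : ℝ => f (r * AddCircle.toCircle x)) (𝓝[<] 1) (𝓝 (F x))) ∧
      (∀ r ∈ Set.Ioo (0 : ℝ) 1,
        ∫⁻ x : 𝕋, ‖f (r * AddCircle.toCircle x)‖ₑ ^ 2 ∂AddCircle.haarAddCircle ≤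
          ∫⁻ x, ‖F x‖ₑ ^ 2 ∂AddCircle.haarAddCircle) ∧
      ∫ x, F x ∂AddCircle.haarAddCircle = f 0 := by
  obtain ⟨F, hF, hlim, hle⟩ := exists_boundary_function hf hC hfC
  have hpoisson : ∀ w : ℂ, ‖w‖ < 1 → _ := fun w hw =>
    integral_poissonKernel_smul_boundary hf hF hlim hw
  refine ⟨F, ?_, hle, ?_⟩
  · filter_upwards [ae_tendsto_integral_poissonKernel (hF.integrable (by norm_num))] with x hx
    refine hx.congr' ?_
    filter_upwards [Ioo_mem_nhdsLT (zero_lt_one' ℝ)] with r hr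
    exact hpoisson _ (by rw [norm_ofReal_mul_toCircle hr.1.le]; exact hr.2)
  · have h0 := hpoisson 0 (by simp)
    simpa [poissonKernel_def] using h0

/-! ### The circle action on the distinguished boundary -/

/-- Multiplication by a unimodular scalar, as a map of the unit sphere. -/
def rotateSphere {E : Type*} [NormedAddCommGroup E] [NormedSpace ℂ E] (c : Circle)
    (x : Metric.sphere (0 : E) 1) : Metric.sphere (0 : E) 1 :=
  ⟨(c : ℂ) • (x : E), by
    rw [mem_sphere_zero_iff_norm, norm_smul, Circle.norm_coe, one_mul, norm_eq_of_mem_sphere x]⟩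

lemma continuous_rotateSphere {E : Type*} [NormedAddCommGroup E] [NormedSpace ℂ E] :
    Continuous fun p : Circle × Metric.sphere (0 : E) 1 => rotateSphere p.1 p.2 :=
  Continuous.subtype_mk (by fun_prop) _

open scoped Pointwise in
lemma measurePreserving_rotateSphere {E : Type} [NormedAddCommGroup E] [NormedSpace ℂ E]
    [NormedSpace ℝ E] [SMulCommClass ℝ ℂ E] [MeasureSpace E] [BorelSpace E]
    (c : Circle) (hc : MeasurePreserving (fun x : E => (c : ℂ) • x)) :
    MeasurePreserving (rotateSphere (E := E) c) (sphereMeasure E) (sphereMeasure E) := by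
  have hcont : Continuous (rotateSphere (E := E) c) :=
    continuous_rotateSphere.comp (Continuous.prodMk_right c)
  have hc0 : (c : ℂ) ≠ 0 := Circle.coe_ne_zero c
  refine MeasurePreserving.smul_measure ⟨hcont.measurable, ?_⟩ _
  ext s hs
  rw [Measure.map_apply hcont.measurable hs, Measure.toSphere_apply' _ (hcont.measurable hs),
    Measure.toSphere_apply' _ hs]
  congr 1
  rw [← hc.measure_preimage_emb (Homeomorph.smulOfNeZero (c : ℂ) hc0).measurableEmbedding
    (Set.Ioo (0 : ℝ) 1 • Subtype.val '' s)]
  congr 1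
  ext x
  simp only [Set.mem_smul, Set.mem_image, Set.mem_preimage]
  constructor
  · rintro ⟨r, hr, _, ⟨y, hy, rfl⟩, rfl⟩
    exact ⟨r, hr, _, ⟨rotateSphere c y, hy, rfl⟩, (smul_comm r (c : ℂ) (y : E))⟩
  · rintro ⟨r, hr, _, ⟨y, hy, rfl⟩, hx⟩
    have hinv : rotateSphere c (rotateSphere c⁻¹ y) = y := by
      ext1
      simp [rotateSphere, smul_smul]
    refine ⟨r, hr, _, ⟨rotateSphere c⁻¹ y, by rwa [hinv], rfl⟩, ?_⟩
    have h2 : (rotateSphere c⁻¹ y : E) = (c : ℂ)⁻¹ • (y : E) := by simp [rotateSphere]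
    rw [h2, smul_comm, hx, smul_smul, inv_mul_cancel₀ hc0, one_smul]

lemma measurePreserving_circle_smul {E : Type} [NormedAddCommGroup E] [InnerProductSpace ℝ E]
    [NormedSpace ℂ E] [SMulCommClass ℂ ℝ E] [FiniteDimensional ℝ E] [MeasurableSpace E]
    [BorelSpace E] (c : Circle) :
    MeasurePreserving (fun x : E => (c : ℂ) • x) volume volume := by
  let e : E ≃ₗᵢ[ℝ] E :=
    { toFun := fun x => (c : ℂ) • x
      invFun := fun x => (c : ℂ)⁻¹ • x
      map_add' := smul_add _
      map_smul' := fun r x => smul_comm (c : ℂ) r x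
      left_inv := fun x => by simp [smul_smul]
      right_inv := fun x => by simp [smul_smul]
      norm_map' := fun x => by
        change ‖(c : ℂ) • x‖ = ‖x‖
        rw [norm_smul, Circle.norm_coe, one_mul] }
  exact e.measurePreserving

lemma isProbabilityMeasure_sphereMeasure (E : Type) [NormedAddCommGroup E] [NormedSpace ℝ E]
    [FiniteDimensional ℝ E] [Nontrivial E] [MeasureSpace E] [BorelSpace E]
    [(volume : Measure E).IsAddHaarMeasure] : IsProbabilityMeasure (sphereMeasure E) := by
  have h0 : (volume : Measure E).toSphere Set.univ ≠ 0 :=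
    Measure.measure_univ_ne_zero.2 (Measure.toSphere_ne_zero _)
  refine ⟨?_⟩
  rw [sphereMeasure, Measure.smul_apply, smul_eq_mul,
    ENNReal.inv_mul_cancel h0 (measure_ne_top _ _)]

instance : IsProbabilityMeasure circleMeasure := isProbabilityMeasure_sphereMeasure ℂ

lemma measurePreserving_rotateSphere_circleMeasure (c : Circle) :
    MeasurePreserving (rotateSphere (E := ℂ) c) circleMeasure circleMeasure :=
  measurePreserving_rotateSphere c (measurePreserving_circle_smul c)

-- Instance arguments for measures on products of spheres exceed the default size bound.
set_option synthInstance.maxSize 512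

variable {k : ℕ} {n : Fin k → ℕ}

lemma isProbabilityMeasure_boundaryMeasure (hn : ∀ j, 1 ≤ n j) :
    (∀ j, IsProbabilityMeasure (sphereMeasure (EuclideanSpace ℂ (Fin (n j))))) ∧
    IsProbabilityMeasure (boundaryMeasure n) := by
  have h : ∀ j, IsProbabilityMeasure (sphereMeasure (EuclideanSpace ℂ (Fin (n j)))) := by
    intro j
    have : Nonempty (Fin (n j)) := ⟨⟨0, hn j⟩⟩
    exact isProbabilityMeasure_sphereMeasure _
  exact ⟨h, by unfold boundaryMeasure; infer_instance⟩

/-- The diagonal action of the unit circle on the distinguished boundary. -/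
noncomputable def rotate (c : Circle) (ζ : Boundary n) : Boundary n := fun j => rotateSphere c (ζ j)

lemma continuous_rotate :
    Continuous fun p : Circle × Boundary n => rotate p.1 p.2 :=
  continuous_pi fun j => continuous_rotateSphere.comp
    (continuous_fst.prodMk ((continuous_apply j).comp continuous_snd))

lemma measurePreserving_rotate (hn : ∀ j, 1 ≤ n j) (c : Circle) :
    MeasurePreserving (rotate (n := n) c) (boundaryMeasure n) (boundaryMeasure n) := by
  have := (isProbabilityMeasure_boundaryMeasure hn).1
  exact measurePreserving_pi _ _ fun j =>
    measurePreserving_rotateSphere c (measurePreserving_circle_smul c)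

section Averaging

variable {X Y : Type*} [MeasurableSpace X] [MeasurableSpace Y] {μ : Measure X} {ν : Measure Y}
  {T : X × Y → X}

/-- A measurable family of measure preserving maps, parametrized by a probability space, is
jointly measure preserving. -/
lemma measurePreserving_prod_of_forall [SFinite μ] [IsProbabilityMeasure ν] (hT : Measurable T)
    (h : ∀ y, MeasurePreserving (fun x => T (x, y)) μ μ) : MeasurePreserving T (μ.prod ν) μ := by
  refine ⟨hT, ?_⟩
  ext s hs
  rw [Measure.map_apply hT hs, Measure.prod_apply_symm (hT hs)]
  have h1 : ∀ y, μ ((fun x => (x, y)) ⁻¹' (T ⁻¹' s)) = μ s := fun y =>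
    (h y).measure_preimage hs.nullMeasurableSet
  simp_rw [h1]
  simp

lemma MeasurePreserving.lintegral_eq_lintegral_lintegral [SFinite ν]
    (h : MeasurePreserving T (μ.prod ν) μ) {g : X → ℝ≥0∞} (hg : AEMeasurable g μ) :
    ∫⁻ x, g x ∂μ = ∫⁻ x, ∫⁻ y, g (T (x, y)) ∂ν ∂μ := by
  rw [← lintegral_prod (fun p => g (T p)) (hg.comp_quasiMeasurePreserving h.quasiMeasurePreserving)]
  nth_rw 1 [← h.map_eq]
  rw [← h.map_eq] at hg
  exact lintegral_map' hg h.measurable.aemeasurable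

lemma MeasurePreserving.integral_eq_integral_integral [SFinite μ] [SFinite ν]
    (h : MeasurePreserving T (μ.prod ν) μ) {g : X → ℂ} (hg : Integrable g μ) :
    ∫ x, g x ∂μ = ∫ x, ∫ y, g (T (x, y)) ∂ν ∂μ := by
  have hint : Integrable (fun p => g (T p)) (μ.prod ν) := h.integrable_comp_of_integrable hg
  rw [← integral_prod _ hint]
  nth_rw 1 [← h.map_eq]
  rw [← h.map_eq] at hg
  exact integral_map h.measurable.aemeasurable hg.aestronglyMeasurable

end Averaging

/-- Averaging over the diagonal circle action preserves `Σ`. -/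
lemma measurePreserving_rotate_prod (hn : ∀ j, 1 ≤ n j) :
    MeasurePreserving (fun p : Boundary n × 𝕋 => rotate (AddCircle.toCircle p.2) p.1)
      ((boundaryMeasure n).prod AddCircle.haarAddCircle) (boundaryMeasure n) := by
  have := (isProbabilityMeasure_boundaryMeasure hn).2
  have hcont : Continuous fun p : Boundary n × 𝕋 => rotate (AddCircle.toCircle p.2) p.1 :=
    continuous_rotate.comp ((AddCircle.continuous_toCircle.comp continuous_snd).prodMk
      continuous_fst)
  exact measurePreserving_prod_of_forall hcont.measurable fun x =>
    measurePreserving_rotate hn (AddCircle.toCircle x)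

lemma lintegral_eq_lintegral_rotate (hn : ∀ j, 1 ≤ n j) {g : Boundary n → ℝ≥0∞}
    (hg : AEMeasurable g (boundaryMeasure n)) :
    ∫⁻ ζ, g ζ ∂(boundaryMeasure n) = ∫⁻ ζ, ∫⁻ x : 𝕋, g (rotate (AddCircle.toCircle x) ζ)
      ∂AddCircle.haarAddCircle ∂(boundaryMeasure n) :=
  MeasurePreserving.lintegral_eq_lintegral_lintegral (measurePreserving_rotate_prod hn) hg

lemma integral_eq_integral_rotate (hn : ∀ j, 1 ≤ n j) {g : Boundary n → ℂ}
    (hg : Integrable g (boundaryMeasure n)) :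
    ∫ ζ, g ζ ∂(boundaryMeasure n) = ∫ ζ, ∫ x : 𝕋, g (rotate (AddCircle.toCircle x) ζ)
      ∂AddCircle.haarAddCircle ∂(boundaryMeasure n) := by
  have := (isProbabilityMeasure_boundaryMeasure hn).2
  exact MeasurePreserving.integral_eq_integral_integral (measurePreserving_rotate_prod hn) hg

/-! ### Boundary values in the Hardy space of the product of balls -/

/-- The restriction `z ↦ f (z ζ)` of `f` to the complex disc through `ζ`. -/
noncomputable def slice (f : Ambient n → ℂ) (ζ : Boundary n) (z : ℂ) : ℂ :=
  f fun j => z • (ζ j : EuclideanSpace ℂ (Fin (n j)))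

lemma apply_dilate_rotate (f : Ambient n → ℂ) (r : ℝ) (c : Circle) (ζ : Boundary n) :
    f (dilate r (rotate c ζ)) = slice f ζ (r * c) := by
  refine congrArg f (funext fun j => ?_)
  change (r : ℂ) • (c : ℂ) • (ζ j : EuclideanSpace ℂ (Fin (n j))) = _
  rw [smul_smul]

lemma smul_mem_domain (ζ : Boundary n) {z : ℂ} (hz : ‖z‖ < 1) :
    (fun j => z • (ζ j : EuclideanSpace ℂ (Fin (n j)))) ∈ domain n := by
  intro j
  simpa only [norm_smul, norm_eq_of_mem_sphere (ζ j), mul_one] using hz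

lemma dilate_mem_domain (ζ : Boundary n) {r : ℝ} (hr : r ∈ Set.Ioo (0 : ℝ) 1) :
    dilate r ζ ∈ domain n :=
  smul_mem_domain ζ (by rw [Complex.norm_real, Real.norm_of_nonneg hr.1.le]; exact hr.2)

lemma differentiableOn_slice {f : Ambient n → ℂ} (hf : DifferentiableOn ℂ f (domain n))
    (ζ : Boundary n) : DifferentiableOn ℂ (slice f ζ) (Metric.ball 0 1) := by
  refine hf.comp (differentiableOn_pi.2 fun j => by fun_prop) fun z hz => ?_
  exact smul_mem_domain ζ (by simpa using hz)

lemma continuous_dilate_comp {f : Ambient n → ℂ} (hf : DifferentiableOn ℂ f (domain n)) {r : ℝ}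
    (hr : r ∈ Set.Ioo (0 : ℝ) 1) : Continuous fun ζ : Boundary n => f (dilate r ζ) := by
  refine hf.continuousOn.comp_continuous ?_ fun ζ => dilate_mem_domain ζ hr
  unfold dilate
  fun_prop

lemma continuousOn_radius {f : Ambient n → ℂ} (hf : DifferentiableOn ℂ f (domain n))
    (ζ : Boundary n) : ContinuousOn (fun r : ℝ => f (dilate r ζ)) (Set.Ioo 0 1) := by
  refine hf.continuousOn.comp (Continuous.continuousOn ?_) fun r hr => dilate_mem_domain ζ hr
  unfold dilate
  fun_prop

lemma HasRadialLimit.boundaryValue_eq {f : Ambient n → ℂ} {ζ : Boundary n} {w : ℂ}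
    (h : HasRadialLimit f ζ w) : boundaryValue f ζ = w :=
  Tendsto.limUnder_eq h

/-- For a function continuous on `(0, 1)`, the existence of the limit at `1` can be tested on
rational points. -/
lemma exists_tendsto_iff_rat {g : ℝ → ℂ} (hg : ContinuousOn g (Set.Ioo 0 1)) :
    (∃ w, Tendsto g (𝓝[<] 1) (𝓝 w)) ↔
      ∃ w, Tendsto (fun q : {q : ℚ // (q : ℝ) ∈ Set.Ioo (0 : ℝ) 1} => g (q : ℚ))
        (comap (fun q => ((q : ℚ) : ℝ)) (𝓝[<] 1)) (𝓝 w) := by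
  refine exists_congr fun w => ⟨fun h => h.comp tendsto_comap, fun h => ?_⟩
  rw [Metric.tendsto_nhds]
  intro ε hε
  have h1 := (Metric.tendsto_nhds.1 h) (ε / 2) (by positivity)
  obtain ⟨t, ht, hts⟩ := mem_comap.1 h1
  obtain ⟨a, ha, hat⟩ := (mem_nhdsLT_iff_exists_Ioo_subset).1 ht
  have hmem : Set.Ioo (max a 0) 1 ∈ 𝓝[<] (1 : ℝ) := Ioo_mem_nhdsLT (max_lt ha one_pos)
  filter_upwards [hmem] with r hr
  by_contra hcon
  have hr01 : r ∈ Set.Ioo (0 : ℝ) 1 := ⟨(le_max_right _ _).trans_lt hr.1, hr.2⟩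
  have hc : ContinuousAt g r := hg.continuousAt (Ioo_mem_nhds hr01.1 hr01.2)
  have hev : ∀ᶠ s in 𝓝 r, ε / 2 < dist (g s) w :=
    (hc.dist continuousAt_const).eventually_const_lt (by linarith [not_lt.1 hcon])
  have hev' := hev.and (Ioo_mem_nhds hr.1 hr.2)
  obtain ⟨q, hq1, hq2⟩ := Rat.denseRange_cast.exists_mem_open isOpen_interior
    ⟨r, mem_interior_iff_mem_nhds.2 hev'⟩ |>.imp fun q hq => interior_subset hq
  have hq01 : (q : ℝ) ∈ Set.Ioo (0 : ℝ) 1 := ⟨(le_max_right _ _).trans_lt hq2.1, hq2.2⟩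
  have hlt : dist (g q) w < ε / 2 :=
    hts (show (⟨q, hq01⟩ : {q : ℚ // (q : ℝ) ∈ Set.Ioo (0 : ℝ) 1}) ∈ _ from
      hat ⟨(le_max_left _ _).trans_lt hq2.1, hq2.2⟩)
  linarith

/-- The limit over all radii is not a countable one, which is why rational radii are used. -/
lemma measurableSet_hasRadialLimit {f : Ambient n → ℂ} (hf : DifferentiableOn ℂ f (domain n)) :
    MeasurableSet {ζ : Boundary n | ∃ w, HasRadialLimit f ζ w} := by
  have h : ∀ ζ : Boundary n, (∃ w, HasRadialLimit f ζ w) ↔ _ := fun ζ =>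
    exists_tendsto_iff_rat (continuousOn_radius hf ζ)
  simp_rw [h]
  exact measurableSet_exists_tendsto fun q => (continuous_dilate_comp hf q.2).measurable

/-- The radii `1 - 1 / (m + 2)`, which increase to `1`. -/
noncomputable def radius (m : ℕ) : ℝ := 1 - 1 / (m + 2)

lemma radius_mem (m : ℕ) : radius m ∈ Set.Ioo (0 : ℝ) 1 := by
  have h : (1 : ℝ) / (m + 2) < 1 := by
    rw [div_lt_one (by positivity)]
    linarith [(Nat.cast_nonneg m : (0 : ℝ) ≤ m)]
  exact ⟨sub_pos.2 h, sub_lt_self _ (by positivity)⟩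

lemma tendsto_radius : Tendsto radius atTop (𝓝[<] 1) := by
  refine tendsto_nhdsWithin_iff.2 ⟨?_, Eventually.of_forall fun m => (radius_mem m).2⟩
  have h : Tendsto (fun m : ℕ => 1 / ((m : ℝ) + 2)) atTop (𝓝 0) :=
    tendsto_const_nhds.div_atTop (tendsto_atTop_add_const_right _ _ tendsto_natCast_atTop_atTop)
  rw [← sub_zero (1 : ℝ)]
  exact h.const_sub 1

lemma lintegral_dilate_le_hardyNormSq (f : Ambient n → ℂ) {r : ℝ} (hr : r ∈ Set.Ioo (0 : ℝ) 1) :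
    ∫⁻ ζ, ‖f (dilate r ζ)‖ₑ ^ 2 ∂(boundaryMeasure n) ≤ hardyNormSq f :=
  le_iSup₂ (f := fun (r : ℝ) (_ : r ∈ Set.Ioo (0 : ℝ) 1) =>
    ∫⁻ ζ, ‖f (dilate r ζ)‖ₑ ^ 2 ∂(boundaryMeasure n)) r hr

/-- Almost every slice of a function of `H²(𝒟)` belongs to the Hardy space of the disc. -/
lemma ae_slice_bounded (hn : ∀ j, 1 ≤ n j) {f : Ambient n → ℂ} (hf : f ∈ hardySpace n) :
    ∀ᵐ ζ ∂(boundaryMeasure n), ∃ C : ℝ≥0∞, C ≠ ∞ ∧ ∃ᶠ r : ℝ in 𝓝[<] 1,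
      ∫⁻ x : 𝕋, ‖slice f ζ (r * AddCircle.toCircle x)‖ₑ ^ 2 ∂AddCircle.haarAddCircle ≤ C := by
  set G : ℕ → Boundary n → ℝ≥0∞ := fun m ζ => ∫⁻ x : 𝕋,
    ‖f (dilate (radius m) (rotate (AddCircle.toCircle x) ζ))‖ₑ ^ 2 ∂AddCircle.haarAddCircle with hG
  have hGmeas : ∀ m, Measurable (G m) := by
    intro m
    have hm : Measurable fun p : Boundary n × 𝕋 =>
        ‖f (dilate (radius m) (rotate (AddCircle.toCircle p.2) p.1))‖ₑ ^ 2 :=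
      (((continuous_dilate_comp hf.1 (radius_mem m)).measurable.comp
        (measurePreserving_rotate_prod hn).measurable).enorm).pow_const 2
    exact hm.lintegral_prod_right'
  have hGint : ∀ m, ∫⁻ ζ, G m ζ ∂(boundaryMeasure n) ≤ hardyNormSq f := by
    intro m
    have hm : AEMeasurable (fun ζ => ‖f (dilate (radius m) ζ)‖ₑ ^ 2) (boundaryMeasure n) :=
      ((continuous_dilate_comp hf.1 (radius_mem m)).measurable.enorm.pow_const 2).aemeasurable
    rw [hG, ← lintegral_eq_lintegral_rotate hn hm]
    exact lintegral_dilate_le_hardyNormSq f (radius_mem m)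
  have hlim : ∫⁻ ζ, liminf (fun m => G m ζ) atTop ∂(boundaryMeasure n) ≠ ∞ := by
    refine ((lintegral_liminf_le hGmeas).trans ?_ |>.trans_lt hf.2).ne
    exact liminf_le_of_frequently_le' (Frequently.of_forall hGint)
  filter_upwards [ae_lt_top (Measurable.liminf hGmeas) hlim] with ζ hζ
  refine ⟨liminf (fun m => G m ζ) atTop + 1, ENNReal.add_ne_top.2 ⟨hζ.ne, ENNReal.one_ne_top⟩, ?_⟩
  have hfreq := frequently_lt_of_liminf_lt (h := ENNReal.lt_add_right hζ.ne one_ne_zero)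
  refine tendsto_radius.frequently (hfreq.mono fun m hm => ?_)
  simp only [← apply_dilate_rotate]
  exact hm.le

/-- **Fatou's theorem** for `H²(𝒟)`. -/
theorem ae_hasRadialLimit (hn : ∀ j, 1 ≤ n j) {f : Ambient n → ℂ} (hf : f ∈ hardySpace n) :
    ∀ᵐ ζ ∂(boundaryMeasure n), HasRadialLimit f ζ (boundaryValue f ζ) := by
  have hS := measurableSet_hasRadialLimit hf.1
  suffices h : ∀ᵐ ζ ∂(boundaryMeasure n), ∃ w, HasRadialLimit f ζ w by
    filter_upwards [h] with ζ ⟨w, hw⟩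
    rwa [hw.boundaryValue_eq]
  rw [ae_iff, ← Set.compl_ofPred, ← lintegral_indicator_one hS.compl,
    lintegral_eq_lintegral_rotate hn (measurable_one.indicator hS.compl).aemeasurable]
  refine (lintegral_congr_ae ?_).trans lintegral_zero
  filter_upwards [ae_slice_bounded hn hf] with ζ ⟨C, hC, hfreq⟩
  obtain ⟨F, hF, -⟩ := exists_radial_boundary_function (differentiableOn_slice hf.1 ζ) hC hfreq
  refine (lintegral_congr_ae ?_).trans lintegral_zero
  filter_upwards [hF] with x hx
  have hlim : ∃ w, HasRadialLimit f (rotate (AddCircle.toCircle x) ζ) w :=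
    ⟨F x, by simpa only [HasRadialLimit, apply_dilate_rotate] using hx⟩
  exact Set.indicator_of_notMem (M := ℝ≥0∞) (s := {ζ | ∃ w, HasRadialLimit f ζ w}ᶜ)
    (Set.notMem_compl_iff.2 hlim) _

lemma aemeasurable_boundaryValue (hn : ∀ j, 1 ≤ n j) {f : Ambient n → ℂ} (hf : f ∈ hardySpace n) :
    AEMeasurable (boundaryValue f) (boundaryMeasure n) := by
  refine aemeasurable_of_tendsto_metrizable_ae atTop
    (fun m => (continuous_dilate_comp hf.1 (radius_mem m)).measurable.aemeasurable) ?_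
  filter_upwards [ae_hasRadialLimit hn hf] with ζ hζ
  exact hζ.comp tendsto_radius

/-- On almost every circle orbit, the boundary values of `f ∈ H²(𝒟)` are those of a function in the
Hardy space of the disc. -/
lemma ae_orbit_boundaryValue (hn : ∀ j, 1 ≤ n j) {f : Ambient n → ℂ} (hf : f ∈ hardySpace n) :
    ∀ᵐ ζ ∂(boundaryMeasure n),
      (∀ r ∈ Set.Ioo (0 : ℝ) 1, ∫⁻ x : 𝕋, ‖f (dilate r (rotate (AddCircle.toCircle x) ζ))‖ₑ ^ 2
          ∂AddCircle.haarAddCircle ≤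
        ∫⁻ x : 𝕋, ‖boundaryValue f (rotate (AddCircle.toCircle x) ζ)‖ₑ ^ 2
          ∂AddCircle.haarAddCircle) ∧
      ∫ x : 𝕋, boundaryValue f (rotate (AddCircle.toCircle x) ζ) ∂AddCircle.haarAddCircle =
        f 0 := by
  filter_upwards [ae_slice_bounded hn hf] with ζ ⟨C, hC, hfreq⟩
  obtain ⟨F, hF, hle, hF0⟩ :=
    exists_radial_boundary_function (differentiableOn_slice hf.1 ζ) hC hfreq
  have hae : ∀ᵐ x : 𝕋 ∂AddCircle.haarAddCircle,
      boundaryValue f (rotate (AddCircle.toCircle x) ζ) = F x := by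
    filter_upwards [hF] with x hx
    refine HasRadialLimit.boundaryValue_eq ?_
    simpa only [HasRadialLimit, apply_dilate_rotate] using hx
  constructor
  · intro r hr
    simp only [apply_dilate_rotate]
    refine (hle r hr).trans_eq (lintegral_congr_ae ?_)
    filter_upwards [hae] with x hx
    rw [hx]
  · rw [integral_congr_ae hae, hF0, slice]
    simp [Pi.zero_def]

/-- The `H²` norm is the `L²` norm of the boundary values. -/
theorem hardyNormSq_eq_lintegral_boundaryValue (hn : ∀ j, 1 ≤ n j) {f : Ambient n → ℂ}
    (hf : f ∈ hardySpace n) :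
    hardyNormSq f = ∫⁻ ζ, ‖boundaryValue f ζ‖ₑ ^ 2 ∂(boundaryMeasure n) := by
  apply le_antisymm
  · refine iSup₂_le fun r hr => ?_
    rw [lintegral_eq_lintegral_rotate hn
      ((continuous_dilate_comp hf.1 hr).measurable.enorm.pow_const 2).aemeasurable,
      lintegral_eq_lintegral_rotate hn ((aemeasurable_boundaryValue hn hf).enorm.pow_const 2)]
    refine lintegral_mono_ae ?_
    filter_upwards [ae_orbit_boundaryValue hn hf] with ζ hζ
    exact hζ.1 r hr
  · -- Fatou's lemma along the radii `radius m`.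
    have h1 : ∫⁻ ζ, ‖boundaryValue f ζ‖ₑ ^ 2 ∂(boundaryMeasure n) =
        ∫⁻ ζ, liminf (fun m => ‖f (dilate (radius m) ζ)‖ₑ ^ 2) atTop ∂(boundaryMeasure n) := by
      refine lintegral_congr_ae ?_
      filter_upwards [ae_hasRadialLimit hn hf] with ζ hζ
      have h2 : Tendsto (fun m => ‖f (dilate (radius m) ζ)‖ₑ ^ 2) atTop
          (𝓝 (‖boundaryValue f ζ‖ₑ ^ 2)) :=
        ENNReal.Tendsto.pow (hζ.comp tendsto_radius).enorm
      exact h2.liminf_eq.symm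
    rw [h1]
    refine (lintegral_liminf_le fun m =>
      (continuous_dilate_comp hf.1 (radius_mem m)).measurable.enorm.pow_const 2).trans ?_
    exact liminf_le_of_frequently_le' (Frequently.of_forall fun m =>
      lintegral_dilate_le_hardyNormSq f (radius_mem m))

lemma memLp_boundaryValue (hn : ∀ j, 1 ≤ n j) {f : Ambient n → ℂ} (hf : f ∈ hardySpace n) :
    MemLp (boundaryValue f) 2 (boundaryMeasure n) := by
  refine ⟨(aemeasurable_boundaryValue hn hf).aestronglyMeasurable, ?_⟩
  have h := hf.2
  rw [hardyNormSq_eq_lintegral_boundaryValue hn hf, lintegral_enorm_sq_eq_eLpNorm_sq] at h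
  exact (ENNReal.pow_lt_top_iff.1 h).resolve_right (by norm_num)

/-- The mean value property for boundary values. -/
lemma integral_boundaryValue (hn : ∀ j, 1 ≤ n j) {f : Ambient n → ℂ} (hf : f ∈ hardySpace n) :
    ∫ ζ, boundaryValue f ζ ∂(boundaryMeasure n) = f 0 := by
  have := (isProbabilityMeasure_boundaryMeasure hn).2
  rw [integral_eq_integral_rotate hn ((memLp_boundaryValue hn hf).integrable (by norm_num)),
    integral_congr_ae ((ae_orbit_boundaryValue hn hf).mono fun ζ hζ => hζ.2), integral_const]
  simp

/-! ### Measures on the circle and their moments -/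

/-- Finite measures on `ℝ / 2πℤ` are determined by their Fourier coefficients. -/
lemma measure_addCircle_ext {P P' : Measure 𝕋} [IsFiniteMeasure P] [IsFiniteMeasure P']
    (h : ∀ m : ℤ, ∫ x, fourier m x ∂P = ∫ x, fourier m x ∂P') : P = P' := by
  have hint : ∀ (R : Measure 𝕋) [IsFiniteMeasure R] (g : C(𝕋, ℂ)), Integrable g R := fun R _ g =>
    g.continuous.integrable_of_hasCompactSupport (HasCompactSupport.of_compactSpace _)
  refine ext_of_forall_mem_subalgebra_integral_eq_of_polish (𝕜 := ℂ)
    (A := (fourierSubalgebra (T := 2 * Real.pi)).comap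
      (BoundedContinuousFunction.toContinuousMapStarₐ ℂ)) ?_ fun g hg => ?_
  · intro x y hxy
    obtain ⟨-, ⟨g, hg, rfl⟩, hne⟩ := fourierSubalgebra_separatesPoints hxy
    exact ⟨g, ⟨g, ⟨BoundedContinuousFunction.mkOfCompact g, hg, rfl⟩, rfl⟩, hne⟩
  · have hspan : (BoundedContinuousFunction.toContinuousMapStarₐ ℂ g : C(𝕋, ℂ)) ∈
        Submodule.span ℂ (Set.range (fourier (T := 2 * Real.pi))) := by
      rw [← fourierSubalgebra_coe]
      exact hg
    have key : ∀ f ∈ Submodule.span ℂ (Set.range (fourier (T := 2 * Real.pi))),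
        ∫ x, f x ∂P = ∫ x, f x ∂P' := by
      intro f hf
      induction hf using Submodule.span_induction with
      | mem f hf => obtain ⟨m, rfl⟩ := hf; exact h m
      | zero => simp
      | add f g _ _ hf hg =>
        simp only [ContinuousMap.add_apply]
        rw [integral_add (hint P f) (hint P g), integral_add (hint P' f) (hint P' g), hf, hg]
      | smul c f _ hf =>
        simp only [ContinuousMap.smul_apply]
        rw [integral_smul, integral_smul, hf]
    exact key _ hspan

/-- Finite measures on the unit circle are determined by their moments. -/
lemma measure_circle_ext {P P' : Measure (Metric.sphere (0 : ℂ) 1)} [IsFiniteMeasure P]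
    [IsFiniteMeasure P'] (h0 : P Set.univ = P' Set.univ)
    (h : ∀ m : ℕ, 1 ≤ m → ∫ w, (w : ℂ) ^ m ∂P = ∫ w, (w : ℂ) ^ m ∂P') : P = P' := by
  let e : 𝕋 ≃ₜ Circle := AddCircle.homeomorphCircle Real.two_pi_pos.ne'
  have he : ∀ x, e x = AddCircle.toCircle x := AddCircle.homeomorphCircle_apply _
  let σ : Metric.sphere (0 : ℂ) 1 → 𝕋 := fun w => e.symm ⟨w, w.2⟩
  have hσ : Continuous σ := e.symm.continuous.comp (continuous_subtype_val.subtype_mk _)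
  let τ : 𝕋 → Metric.sphere (0 : ℂ) 1 := fun x => ⟨(e x : Circle), (e x).2⟩
  have hτ : Continuous τ := (continuous_subtype_val.comp e.continuous).subtype_mk _
  have heσ : ∀ w, ((e (σ w) : Circle) : ℂ) = w := fun w =>
    congrArg (fun z : Circle => (z : ℂ)) (e.apply_symm_apply _)
  have hτσ : τ ∘ σ = id := funext fun w => Subtype.ext (heσ w)
  have hfour : ∀ (m : ℤ) w, fourier m (σ w) = (w : ℂ) ^ m := by
    intro m w
    rw [fourier_apply, AddCircle.toCircle_zsmul, ← he, Circle.coe_zpow, heσ]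
  have hz : ∀ m : ℤ, ∫ w, (w : ℂ) ^ m ∂P = ∫ w, (w : ℂ) ^ m ∂P' := by
    intro m
    obtain ⟨j, rfl | rfl⟩ := m.eq_nat_or_neg
    · rcases j.eq_zero_or_pos with rfl | hj
      · simp [measureReal_def, h0]
      · simpa using h j hj
    · rcases j.eq_zero_or_pos with rfl | hj
      · simp [measureReal_def, h0]
      · have hconj : ∀ w : Metric.sphere (0 : ℂ) 1, (w : ℂ) ^ (-(j : ℤ)) = conj ((w : ℂ) ^ j) := by
          intro w
          rw [zpow_neg, zpow_natCast, ← inv_pow, Complex.inv_eq_conj (norm_eq_of_mem_sphere w),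
            map_pow]
        simp_rw [hconj]
        rw [integral_conj, integral_conj, h j hj]
  have hmap : P.map σ = P'.map σ := by
    refine measure_addCircle_ext fun m => ?_
    rw [integral_map hσ.measurable.aemeasurable (fourier m).continuous.aestronglyMeasurable,
      integral_map hσ.measurable.aemeasurable (fourier m).continuous.aestronglyMeasurable]
    simp_rw [hfour]
    exact hz m
  have hback : ∀ R : Measure (Metric.sphere (0 : ℂ) 1), (R.map σ).map τ = R := by
    intro R
    rw [Measure.map_map hτ.measurable hσ.measurable, hτσ, Measure.map_id]
  rw [← hback P, hmap, hback]

/-- The moments of Lebesgue measure on the circle vanish, by rotation invariance. -/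
lemma integral_pow_circleMeasure {m : ℕ} (hm : 1 ≤ m) :
    ∫ w : Metric.sphere (0 : ℂ) 1, (w : ℂ) ^ m ∂circleMeasure = 0 := by
  -- Rotation by `c` with `cᵐ = -1` changes the sign of the integral.
  set c : Circle := Circle.exp (Real.pi / m) with hc
  have hm0 : (m : ℂ) ≠ 0 := by exact_mod_cast (by omega : m ≠ 0)
  have hcm : (c : ℂ) ^ m = -1 := by
    rw [hc, Circle.coe_exp, ← Complex.exp_nat_mul, ← Complex.exp_pi_mul_I]
    congr 1
    push_cast
    field_simp
  have h := measurePreserving_rotateSphere_circleMeasure c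
  have hcont : Continuous fun w : Metric.sphere (0 : ℂ) 1 => (w : ℂ) ^ m := by fun_prop
  have h1 : ∫ w : Metric.sphere (0 : ℂ) 1, (w : ℂ) ^ m ∂circleMeasure =
      ∫ w : Metric.sphere (0 : ℂ) 1, (c : ℂ) ^ m * (w : ℂ) ^ m ∂circleMeasure := by
    nth_rw 1 [← h.map_eq]
    rw [integral_map h.measurable.aemeasurable hcont.aestronglyMeasurable]
    simp only [rotateSphere, smul_eq_mul, mul_pow]
  rw [integral_const_mul, hcm, neg_one_mul] at h1
  exact self_eq_neg.1 h1

/-! ### Inner functions and the large model space -/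

lemma zero_mem_domain : (0 : Ambient n) ∈ domain n := fun j => by simp

lemma mem_hardySpace_of_bounded (hn : ∀ j, 1 ≤ n j) {f : Ambient n → ℂ}
    (hf : DifferentiableOn ℂ f (domain n)) {B : ℝ≥0} (hB : ∀ z ∈ domain n, ‖f z‖₊ ≤ B) :
    f ∈ hardySpace n := by
  have := (isProbabilityMeasure_boundaryMeasure hn).2
  refine ⟨hf, (iSup₂_le fun r hr => ?_).trans_lt (ENNReal.coe_lt_top (r := B ^ 2))⟩
  refine (lintegral_mono fun ζ => ?_).trans_eq (lintegral_const _ |>.trans (by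
    rw [measure_univ, mul_one]))
  rw [ENNReal.coe_pow]
  gcongr
  exact ENNReal.coe_le_coe.2 (hB _ (dilate_mem_domain ζ hr))

namespace IsInner

variable {I : Ambient n → ℂ}

lemma pow_mul_mem_hardySpace (hI : IsInner I) (m : ℕ) {g : Ambient n → ℂ}
    (hg : g ∈ hardySpace n) : (fun z => I z ^ m * g z) ∈ hardySpace n := by
  refine ⟨(hI.holomorphic.pow m).mul hg.1, (iSup₂_le fun r hr => ?_).trans_lt hg.2⟩
  refine (lintegral_mono fun ζ => ?_).trans (lintegral_dilate_le_hardyNormSq g hr)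
  gcongr
  rw [enorm_mul, enorm_pow]
  refine mul_le_of_le_one_left' (pow_le_one₀ zero_le ?_)
  rw [← ofReal_norm, ENNReal.ofReal_le_one]
  exact (hI.norm_lt_one _ (dilate_mem_domain ζ hr)).le

lemma mem_hardySpace (hI : IsInner I) (hn : ∀ j, 1 ≤ n j) : I ∈ hardySpace n :=
  mem_hardySpace_of_bounded hn hI.holomorphic (B := 1) fun z hz => (hI.norm_lt_one z hz).le

/-- A measurable version, with values in the unit circle, of the boundary function of an inner
function. -/
lemma exists_boundary_map (hI : IsInner I) (hn : ∀ j, 1 ≤ n j) :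
    ∃ φ : Boundary n → Metric.sphere (0 : ℂ) 1, Measurable φ ∧
      ∀ᵐ ζ ∂(boundaryMeasure n), HasRadialLimit I ζ (φ ζ) := by
  have hm := aemeasurable_boundaryValue hn (hI.mem_hardySpace hn)
  set g := hm.mk with hg
  have hgm : Measurable g := hm.measurable_mk
  classical
  -- The value `1` off the set where `g` is unimodular is arbitrary.
  refine ⟨fun ζ => ⟨if ‖g ζ‖ = 1 then g ζ else 1, ?_⟩, ?_, ?_⟩
  · split_ifs with h <;> simp [h]
  · exact Measurable.subtype_mk (Measurable.ite
      (measurableSet_eq_fun hgm.norm measurable_const) hgm measurable_const)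
  · filter_upwards [hI.unimodular, hm.ae_eq_mk] with ζ ⟨w, hw, hw1⟩ hζ
    rw [hw.boundaryValue_eq] at hζ
    have : g ζ = w := hζ.symm
    simpa [this, hw1] using hw

variable {φ : Boundary n → Metric.sphere (0 : ℂ) 1}

/-- Orthogonality of `f` to `I · Iᵐ⁻¹ f` says that the `m`-th moment of the image of `|f|² Σ`
under `I` vanishes. -/
lemma integral_pow_smul_eq_zero (hI : IsInner I) (hn : ∀ j, 1 ≤ n j)
    (hφ : ∀ᵐ ζ ∂(boundaryMeasure n), HasRadialLimit I ζ (φ ζ))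
    {f : Ambient n → ℂ} (hf : f ∈ largeModelSpace I) {m : ℕ} (hm : 1 ≤ m) :
    ∫ ζ, (‖boundaryValue f ζ‖₊ ^ 2 : ℝ≥0) • (φ ζ : ℂ) ^ m ∂(boundaryMeasure n) = 0 := by
  have h := hf.2 _ (hI.pow_mul_mem_hardySpace (m - 1) hf.1)
  have hinner : hardyInner f (fun z => I z * (I z ^ (m - 1) * f z)) =
      ∫ ζ, conj ((‖boundaryValue f ζ‖₊ ^ 2 : ℝ≥0) • (φ ζ : ℂ) ^ m) ∂(boundaryMeasure n) := by
    refine integral_congr_ae ?_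
    filter_upwards [hφ, ae_hasRadialLimit hn hf.1] with ζ h1 h2
    have h3 : HasRadialLimit (fun z => I z * (I z ^ (m - 1) * f z)) ζ
        (φ ζ * ((φ ζ : ℂ) ^ (m - 1) * boundaryValue f ζ)) := h1.mul ((h1.pow (m - 1)).mul h2)
    rw [h3.boundaryValue_eq, ← mul_assoc, ← pow_succ', Nat.sub_add_cancel hm, NNReal.smul_def,
      Complex.real_smul]
    simp only [map_mul, map_pow, Complex.conj_ofReal]
    rw [← mul_assoc, mul_comm (boundaryValue f ζ), mul_assoc, Complex.mul_conj,
      Complex.normSq_eq_norm_sq, mul_comm]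
    push_cast
    simp
  rw [hinner, integral_conj, map_eq_zero] at h
  exact h

/-- For `f` in the large model space, the image of `|f|² Σ` under `I` is a multiple of Lebesgue
measure on the circle. -/
theorem map_withDensity_eq (hI : IsInner I) (hn : ∀ j, 1 ≤ n j) (hφm : Measurable φ)
    (hφ : ∀ᵐ ζ ∂(boundaryMeasure n), HasRadialLimit I ζ (φ ζ))
    {f : Ambient n → ℂ} (hf : f ∈ largeModelSpace I) :
    ((boundaryMeasure n).withDensity fun ζ => ‖boundaryValue f ζ‖ₑ ^ 2).map φ =
      hardyNormSq f • circleMeasure := by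
  have hnorm := hardyNormSq_eq_lintegral_boundaryValue hn hf.1
  have hfin : IsFiniteMeasure
      ((boundaryMeasure n).withDensity fun ζ => ‖boundaryValue f ζ‖ₑ ^ 2) :=
    isFiniteMeasure_withDensity (hnorm ▸ hf.1.2.ne)
  have hfin' : IsFiniteMeasure (hardyNormSq f • circleMeasure) :=
    Measure.smul_finite _ hf.1.2.ne
  refine measure_circle_ext ?_ fun m hm => ?_
  · rw [Measure.map_apply hφm .univ, Set.preimage_univ, withDensity_apply _ .univ,
      setLIntegral_univ, ← hnorm, Measure.smul_apply, measure_univ, smul_eq_mul, mul_one]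
  · have hcont : Continuous fun w : Metric.sphere (0 : ℂ) 1 => (w : ℂ) ^ m := by fun_prop
    rw [integral_smul_measure, integral_pow_circleMeasure hm, smul_zero,
      integral_map hφm.aemeasurable hcont.aestronglyMeasurable]
    have hdens : (fun ζ => ‖boundaryValue f ζ‖ₑ ^ 2) =
        fun ζ => ((‖boundaryValue f ζ‖₊ ^ 2 : ℝ≥0) : ℝ≥0∞) := by
      funext ζ
      rw [ENNReal.coe_pow, enorm_eq_nnnorm]
    rw [hdens, integral_withDensity_eq_integral_smul₀
      ((aemeasurable_boundaryValue hn hf.1).nnnorm.pow_const 2)]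
    exact hI.integral_pow_smul_eq_zero hn hφ hf hm

lemma setLIntegral_preimage (hI : IsInner I) (hn : ∀ j, 1 ≤ n j) (hφm : Measurable φ)
    (hφ : ∀ᵐ ζ ∂(boundaryMeasure n), HasRadialLimit I ζ (φ ζ))
    {f : Ambient n → ℂ} (hf : f ∈ largeModelSpace I) {Q : Set (Metric.sphere (0 : ℂ) 1)}
    (hQ : MeasurableSet Q) :
    ∫⁻ ζ in φ ⁻¹' Q, ‖boundaryValue f ζ‖ₑ ^ 2 ∂(boundaryMeasure n) =
      hardyNormSq f * circleMeasure Q := by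
  rw [← withDensity_apply _ (hφm hQ), ← Measure.map_apply hφm hQ,
    hI.map_withDensity_eq hn hφm hφ hf, Measure.smul_apply, smul_eq_mul]

/-- The reproducing kernel `1 - \overline{I(0)} I` of the large model space at the origin. -/
noncomputable def kernelZero (I : Ambient n → ℂ) (z : Ambient n) : ℂ := 1 - conj (I 0) * I z

lemma kernelZero_mem_hardySpace (hI : IsInner I) (hn : ∀ j, 1 ≤ n j) :
    kernelZero I ∈ hardySpace n := by
  refine mem_hardySpace_of_bounded hn ((hI.holomorphic.const_mul _).const_sub _) (B := 2)
    fun z hz => ?_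
  have h1 := (hI.norm_lt_one z hz).le
  have h2 := (hI.norm_lt_one 0 zero_mem_domain).le
  have h3 : ‖conj (I 0) * I z‖ ≤ 1 := by
    rw [norm_mul, RCLike.norm_conj]
    exact mul_le_one₀ h2 (norm_nonneg _) h1
  have h4 : ‖kernelZero I z‖ ≤ ‖(1 : ℂ)‖ + ‖conj (I 0) * I z‖ := norm_sub_le _ _
  rw [norm_one] at h4
  rw [← NNReal.coe_le_coe, coe_nnnorm, NNReal.coe_ofNat]
  linarith

lemma ae_boundaryValue_kernelZero
    (hφ : ∀ᵐ ζ ∂(boundaryMeasure n), HasRadialLimit I ζ (φ ζ)) :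
    ∀ᵐ ζ ∂(boundaryMeasure n), boundaryValue (kernelZero I) ζ = 1 - conj (I 0) * φ ζ := by
  filter_upwards [hφ] with ζ hζ
  exact HasRadialLimit.boundaryValue_eq (tendsto_const_nhds.sub (hζ.const_mul _))

/-- Orthogonality to `I g` amounts to the mean value property for `I g` and `g`. -/
lemma kernelZero_mem (hI : IsInner I) (hn : ∀ j, 1 ≤ n j) :
    kernelZero I ∈ largeModelSpace I := by
  refine ⟨hI.kernelZero_mem_hardySpace hn, fun g hg => ?_⟩
  have := (isProbabilityMeasure_boundaryMeasure hn).2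
  obtain ⟨φ, -, hφ⟩ := hI.exists_boundary_map hn
  have hIg : (fun z => I z * g z) ∈ hardySpace n := by
    simpa using hI.pow_mul_mem_hardySpace 1 hg
  have hintg := (memLp_boundaryValue hn hg).integrable (by norm_num)
  have hintIg := (memLp_boundaryValue hn hIg).integrable (by norm_num)
  have hconj : hardyInner (kernelZero I) (fun z => I z * g z) =
      ∫ ζ, conj (boundaryValue (fun z => I z * g z) ζ - I 0 * boundaryValue g ζ)
        ∂(boundaryMeasure n) := by
    refine integral_congr_ae ?_
    filter_upwards [hφ, ae_boundaryValue_kernelZero hφ, ae_hasRadialLimit hn hg] with ζ h1 h2 h3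
    have h4 : HasRadialLimit (fun z => I z * g z) ζ (φ ζ * boundaryValue g ζ) := h1.mul h3
    have h5 : (φ ζ : ℂ) * conj (φ ζ : ℂ) = 1 := by
      rw [Complex.mul_conj, Complex.normSq_eq_norm_sq, norm_eq_of_mem_sphere]
      norm_num
    rw [h2, h4.boundaryValue_eq]
    simp only [map_mul, map_sub]
    linear_combination (-conj (I 0) * conj (boundaryValue g ζ)) * h5
  rw [hconj, integral_conj, integral_sub hintIg (hintg.const_mul _), integral_const_mul,
    integral_boundaryValue hn hIg, integral_boundaryValue hn hg, sub_self, map_zero]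

lemma ae_boundaryValue_kernelZero_ne_zero (hI : IsInner I)
    (hφ : ∀ᵐ ζ ∂(boundaryMeasure n), HasRadialLimit I ζ (φ ζ)) :
    ∀ᵐ ζ ∂(boundaryMeasure n), boundaryValue (kernelZero I) ζ ≠ 0 := by
  filter_upwards [ae_boundaryValue_kernelZero hφ] with ζ hζ h0
  rw [hζ, sub_eq_zero] at h0
  have h1 := congrArg norm h0
  rw [norm_one, norm_mul, RCLike.norm_conj, norm_eq_of_mem_sphere, mul_one] at h1
  exact absurd h1 (hI.norm_lt_one 0 zero_mem_domain).ne'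

/-- Since the kernel at the origin does not vanish almost everywhere on the boundary, the preimage
of `Q` has measure zero exactly when `Q` does. -/
lemma measure_preimage_eq_zero_iff (hI : IsInner I) (hn : ∀ j, 1 ≤ n j) (hφm : Measurable φ)
    (hφ : ∀ᵐ ζ ∂(boundaryMeasure n), HasRadialLimit I ζ (φ ζ))
    {Q : Set (Metric.sphere (0 : ℂ) 1)} (hQ : MeasurableSet Q) :
    boundaryMeasure n (φ ⁻¹' Q) = 0 ↔ circleMeasure Q = 0 := by
  have hK := hI.kernelZero_mem hn
  have hne := hI.ae_boundaryValue_kernelZero_ne_zero hφ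
  have hset := hI.setLIntegral_preimage hn hφm hφ hK hQ
  have hmeas : AEMeasurable (fun ζ => ‖boundaryValue (kernelZero I) ζ‖ₑ ^ 2) (boundaryMeasure n) :=
    (aemeasurable_boundaryValue hn hK.1).enorm.pow_const 2
  have hiff : ∀ A : Set (Boundary n),
      ∫⁻ ζ in A, ‖boundaryValue (kernelZero I) ζ‖ₑ ^ 2 ∂(boundaryMeasure n) = 0 ↔
        boundaryMeasure n A = 0 := by
    intro A
    rw [lintegral_eq_zero_iff' hmeas.restrict]
    constructor
    · intro h
      have hfalse : ∀ᵐ ζ ∂(boundaryMeasure n).restrict A, False := by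
        filter_upwards [h, ae_restrict_of_ae hne] with ζ h1 h2
        exact h2 (by simpa using h1)
      simpa [ae_iff] using hfalse
    · intro h
      rw [Measure.restrict_eq_zero.2 h]
      exact ae_zero.symm ▸ trivial
  have hnz : hardyNormSq (kernelZero I) ≠ 0 := by
    have := (isProbabilityMeasure_boundaryMeasure hn).2
    rw [hardyNormSq_eq_lintegral_boundaryValue hn hK.1, ← setLIntegral_univ, Ne, hiff, measure_univ]
    exact one_ne_zero
  rw [← hiff, hset, mul_eq_zero, or_iff_right hnz]

lemma quasiMeasurePreserving (hI : IsInner I) (hn : ∀ j, 1 ≤ n j) (hφm : Measurable φ)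
    (hφ : ∀ᵐ ζ ∂(boundaryMeasure n), HasRadialLimit I ζ (φ ζ)) :
    Measure.QuasiMeasurePreserving φ (boundaryMeasure n) circleMeasure := by
  refine ⟨hφm, Measure.AbsolutelyContinuous.mk fun N hN h0 => ?_⟩
  rw [Measure.map_apply hφm hN]
  exact (hI.measure_preimage_eq_zero_iff hn hφm hφ hN).2 h0

/-- The preimage under an inner function of a set of intermediate measure is dominant. -/
theorem isDominant_boundaryPreimage (hI : IsInner I) (hn : ∀ j, 1 ≤ n j)
    {Q : Set (Metric.sphere (0 : ℂ) 1)} (hQ : NullMeasurableSet Q circleMeasure)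
    (hQ0 : 0 < circleMeasure Q) (hQ1 : circleMeasure Q < 1) :
    IsDominant I (boundaryPreimage I Q) := by
  have := (isProbabilityMeasure_boundaryMeasure hn).2
  obtain ⟨φ, hφm, hφ⟩ := hI.exists_boundary_map hn
  have hqmp := hI.quasiMeasurePreserving hn hφm hφ
  obtain ⟨Q', -, hQ'm, hQ'⟩ := hQ.exists_measurable_superset_ae_eq
  have hEφ : boundaryPreimage I Q =ᵐ[boundaryMeasure n] φ ⁻¹' Q := by
    filter_upwards [hφ] with ζ hζ
    refine propext ⟨?_, fun h => ⟨φ ζ, h, hζ⟩⟩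
    rintro ⟨q, hq, hqlim⟩
    have hqφ : q = φ ζ := Subtype.ext (tendsto_nhds_unique hqlim hζ)
    rw [hqφ] at hq
    exact hq
  have hE : boundaryPreimage I Q =ᵐ[boundaryMeasure n] φ ⁻¹' Q' :=
    hEφ.trans (hqmp.preimage_ae_eq hQ'.symm)
  have hmQ : circleMeasure Q' = circleMeasure Q := measure_congr hQ'
  refine ⟨(hφm hQ'm).nullMeasurableSet.congr hE.symm, ?_, (circleMeasure Q)⁻¹.toNNReal,
    fun f hf => ?_⟩
  · rw [measure_congr hE]
    refine lt_of_le_of_ne prob_le_one fun h => ?_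
    have hc : boundaryMeasure n (φ ⁻¹' Q'ᶜ) = 0 := by
      rw [Set.preimage_compl, prob_compl_eq_zero_iff (hφm hQ'm), h]
    rw [hI.measure_preimage_eq_zero_iff hn hφm hφ hQ'm.compl, prob_compl_eq_zero_iff hQ'm, hmQ] at hc
    exact hQ1.ne hc
  · have hfin : (circleMeasure Q)⁻¹ ≠ ∞ := ENNReal.inv_ne_top.2 hQ0.ne'
    rw [ENNReal.coe_toNNReal hfin, setLIntegral_congr hE,
      hI.setLIntegral_preimage hn hφm hφ hf hQ'm, hmQ, mul_comm, mul_assoc,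
      ENNReal.mul_inv_cancel hQ0.ne' (measure_ne_top _ _), mul_one]

end IsInner

/-- The open right half of the circle has measure strictly between `0` and `1`. -/
lemma exists_measurableSet_circleMeasure :
    ∃ Q : Set (Metric.sphere (0 : ℂ) 1), MeasurableSet Q ∧ 0 < circleMeasure Q ∧
      circleMeasure Q < 1 := by
  have hpos : ∀ U : Set (Metric.sphere (0 : ℂ) 1), IsOpen U → U.Nonempty →
      0 < circleMeasure U := by
    intro U hU hne
    rw [circleMeasure, sphereMeasure, Measure.smul_apply, smul_eq_mul]
    exact ENNReal.mul_pos (ENNReal.inv_ne_zero.2 (measure_ne_top _ _)) (hU.measure_pos _ hne).ne'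
  have hre : Continuous fun w : Metric.sphere (0 : ℂ) 1 => (w : ℂ).re := by fun_prop
  have hR : IsOpen {w : Metric.sphere (0 : ℂ) 1 | 0 < (w : ℂ).re} := isOpen_lt continuous_const hre
  have hL : IsOpen {w : Metric.sphere (0 : ℂ) 1 | (w : ℂ).re < 0} := isOpen_lt hre continuous_const
  refine ⟨_, hR.measurableSet, hpos _ hR ⟨⟨1, by simp⟩, by simp⟩,
    lt_of_le_of_ne prob_le_one fun h => ?_⟩
  have hc := (prob_compl_eq_zero_iff hR.measurableSet).2 h
  refine (hpos _ hL ⟨⟨-1, by simp⟩, by simp⟩).ne' (measure_mono_null (fun w hw => ?_) hc)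
  exact not_lt.2 (Set.mem_ofPred.1 hw).le

end DominantSets

theorem theorem1 {k : ℕ} (hk : 1 ≤ k) (n : Fin k → ℕ) (hn : ∀ j, 1 ≤ n j)
    (I : DominantSets.Ambient n → ℂ) (hI : DominantSets.IsInner I) :
    (∃ E : Set (DominantSets.Boundary n), DominantSets.IsDominant I E) ∧
    (∀ Q : Set (Metric.sphere (0 : ℂ) 1),
      NullMeasurableSet Q DominantSets.circleMeasure →
      0 < DominantSets.circleMeasure Q → DominantSets.circleMeasure Q < 1 →
      DominantSets.IsDominant I (DominantSets.boundaryPreimage I Q)) := by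
  have h : ∀ Q : Set (Metric.sphere (0 : ℂ) 1), NullMeasurableSet Q DominantSets.circleMeasure →
      0 < DominantSets.circleMeasure Q → DominantSets.circleMeasure Q < 1 →
      DominantSets.IsDominant I (DominantSets.boundaryPreimage I Q) :=
    fun Q hQ hQ0 hQ1 => hI.isDominant_boundaryPreimage hn hQ hQ0 hQ1
  obtain ⟨Q, hQ, hQ0, hQ1⟩ := DominantSets.exists_measurableSet_circleMeasure
  exact ⟨⟨_, h Q hQ.nullMeasurableSet hQ0 hQ1⟩, h⟩
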